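/- Let $M$ be a compact connected smooth manifold of dimension $m\ge 1$ and let $(N,g)$ be a connected smooth Riemannian manifold of dimension $n>m$ (both without boundary). Let $\operatorname{Imm}(M,N)$ be the set of smooth immersions $M\to N$, on which the group $\operatorname{Diff}(M)$ of smooth diffeomorphisms of $M$ acts from the right by composition, and let $\pi:\operatorname{Imm}(M,N)\to B_i(M,N)=\operatorname{Imm}(M,N)/\operatorname{Diff}(M)$ be the quotient map. A smooth path in $\operatorname{Imm}(M,N)$ is a family $f(t,\cdot)\in\operatorname{Imm}(M,N)$, $t\in[0,1]$, for which $(t,x)\mapsto f(t,x)$ is smooth on $[0,1]\times M$. Its horizontal length for the $L^2$-metric $G^0_f(h,k)=\int_M g(h,k)\operatorname{vol}(f^*g)$ is $$L^{\mathrm{hor}}_{G^0}(f)=\int_0^1\Bigl(\int_M g(f_t^\bot,f_t^\bot)\operatorname{vol}(f^*g)\Bigr)^{1/2}dt,$$ where $f_t=\partial_t f$, $f_t^\bot(t,x)$ is the component of $f_t(t,x)$ that is $g$-orthogonal to the image of the tangent map at $x$ of $f(t,\cdot)$, and $\operatorname{vol}(f^*g)$ is the Riemannian volume density on $M$ of the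 metric pulled back by $f(t,\cdot)$. The geodesic distance $\operatorname{dist}^{B_i}_{G^0}(F_0,F_1)$ of $F_0,F_1\in B_i(M,N)$ is the infimum of $L^{\mathrm{hor}}_{G^0}(f)$ over all smooth paths $f$ in $\operatorname{Imm}(M,N)$ with $\pi(f(0,\cdot))=F_0$ and $\pi(f(1,\cdot))=F_1$. Let $f_0,f_1\in\operatorname{Imm}(M,N)$ be such that some smooth path in $\operatorname{Imm}(M,N)$ joins $f_0$ to a point of the $\operatorname{Diff}(M)$-orbit of $f_1$. Then for every $\varepsilon>0$ there is a smooth path $f$ in $\operatorname{Imm}(M,N)$ with $f(0,\cdot)=f_0$, $\pi(f(1,\cdot))=\pi(f_1)$ and $L^{\mathrm{hor}}_{G^0}(f)<\varepsilon$. Consequently $\operatorname{dist}^{B_i}_{G^0}(\pi(f_0),\pi(f_1))=0$. -/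

import Mathlib

open scoped Manifold ContDiff Bundle
open MeasureTheory

namespace ShapeSpace

noncomputable section

/-- Tangent spaces of an `n`-dimensional manifold are finite-dimensional (needed for orthogonal
projections). -/
instance tangentSpaceFiniteDimensional {n : ℕ} {N : Type*} [TopologicalSpace N]
    [ChartedSpace (EuclideanSpace ℝ (Fin n)) N] (y : N) :
    FiniteDimensional ℝ (TangentSpace (𝓡 n) y) :=
  inferInstanceAs (FiniteDimensional ℝ (EuclideanSpace ℝ (Fin n)))

/-- `Imm(M, N)`: smooth maps `M → N` all of whose tangent maps are injective. -/
structure Imm (m n : ℕ) (M N : Type*)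
    [TopologicalSpace M] [ChartedSpace (EuclideanSpace ℝ (Fin m)) M]
    [TopologicalSpace N] [ChartedSpace (EuclideanSpace ℝ (Fin n)) N] where
  /-- the underlying map -/
  toFun : M → N
  smooth : ContMDiff (𝓡 m) (𝓡 n) ∞ toFun
  injective_mfderiv : ∀ x, Function.Injective (mfderiv (𝓡 m) (𝓡 n) toFun x)

section Smooth

variable {m n : ℕ} {M N : Type*}
  [TopologicalSpace M] [ChartedSpace (EuclideanSpace ℝ (Fin m)) M]
  [TopologicalSpace N] [ChartedSpace (EuclideanSpace ℝ (Fin n)) N]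

instance Imm.instCoeFun : CoeFun (Imm m n M N) (fun _ => M → N) := ⟨Imm.toFun⟩

/-- `f₀` and `f₁` lie in the same orbit of `Diff(M)`, which acts on `Imm(M, N)` from the right by
composition. -/
def SameOrbit (f₀ f₁ : Imm m n M N) : Prop :=
  ∃ ψ : M ≃ₘ^∞⟮𝓡 m, 𝓡 m⟯ M, ∀ x, f₁ x = f₀ (ψ x)

variable (m n M N) in
/-- The orbit equivalence relation of `Diff(M)` on `Imm(M, N)`. -/
def orbitSetoid : Setoid (Imm m n M N) where
  r := SameOrbit
  iseqv :=
    { refl := fun _ => ⟨Diffeomorph.refl _ _ _, fun _ => rfl⟩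
      symm := by
        rintro f₀ f₁ ⟨ψ, hψ⟩
        exact ⟨ψ.symm, fun x => by rw [hψ, ψ.apply_symm_apply]⟩
      trans := by
        rintro f₀ f₁ f₂ ⟨ψ, hψ⟩ ⟨χ, hχ⟩
        exact ⟨χ.trans ψ, fun x => by rw [hχ, hψ]; rfl⟩ }

variable (m n M N) in
/-- `B_i(M, N) = Imm(M, N) / Diff(M)`. -/
def Bi : Type _ := Quotient (orbitSetoid m n M N)

/-- The projection `π : Imm(M, N) → B_i(M, N)`. -/
def proj (f : Imm m n M N) : Bi m n M N := Quotient.mk (orbitSetoid m n M N) f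

/-- `γ`, restricted to `[0, 1]`, is a smooth path in `Imm(M, N)`: the map `(t, x) ↦ γ t x` is
smooth on `[0, 1] × M`. (The values of `γ` outside `[0, 1]` play no role.) -/
def IsSmoothPath (γ : ℝ → Imm m n M N) : Prop :=
  ContMDiffOn (𝓘(ℝ, ℝ).prod (𝓡 m)) (𝓡 n) ∞ (fun p : ℝ × M => γ p.1 p.2)
    (Set.Icc (0 : ℝ) 1 ×ˢ Set.univ)

/-- The time derivative `γ_t(t, ·)`, a vector field along `γ t`, for `t ∈ [0, 1]`. -/
def velocity (γ : ℝ → Imm m n M N) (t : ℝ) (x : M) : TangentSpace (𝓡 n) (γ t x) :=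
  mfderivWithin 𝓘(ℝ, ℝ) (𝓡 n) (fun s => γ s x) (Set.Icc (0 : ℝ) 1) t (1 : ℝ)

end Smooth

section Riemannian

variable {m n : ℕ} {M N : Type*}
  [TopologicalSpace M] [ChartedSpace (EuclideanSpace ℝ (Fin m)) M]
  [TopologicalSpace N] [ChartedSpace (EuclideanSpace ℝ (Fin n)) N]
  [Bundle.RiemannianBundle (fun y : N => TangentSpace (𝓡 n) y)]

/-- The matrix `(f^*g)_{ij} = g(∂_i f, ∂_j f)` of the pulled back metric in the preferred chart at
`x₀`, as a function of the coordinates `u`. -/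
def pullbackMatrix (f : M → N) (x₀ : M) (u : EuclideanSpace ℝ (Fin m)) :
    Matrix (Fin m) (Fin m) ℝ :=
  Matrix.gram ℝ fun i : Fin m =>
    (mfderiv (𝓡 m) (𝓡 n) (f ∘ (chartAt (EuclideanSpace ℝ (Fin m)) x₀).symm) u
      (EuclideanSpace.single i (1 : ℝ)) :
        TangentSpace (𝓡 n) ((f ∘ (chartAt (EuclideanSpace ℝ (Fin m)) x₀).symm) u))

variable [MeasurableSpace M]

/-- The volume density `vol(f^*g)` on the domain of the preferred chart at `x₀`, as a measure on
`M` supported on this domain: in coordinates it is `√det((f^*g)_{ij}) du`. -/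
def chartVolume (f : M → N) (x₀ : M) : Measure M :=
  ((volume.restrict (chartAt (EuclideanSpace ℝ (Fin m)) x₀).target).withDensity
    fun u => ENNReal.ofReal (√(pullbackMatrix (m := m) (n := n) f x₀ u).det)).map
      (chartAt (EuclideanSpace ℝ (Fin m)) x₀).symm

/-- The volume density `vol(f^*g)` of an immersion as a measure on `M`. The local measures
`chartVolume f x₀` agree on the overlaps of charts, and their supremum (in the lattice of measures)
is the unique measure that restricts to each of them on the corresponding chart domain. -/
def vol (f : Imm m n M N) : Measure M :=
  ⨆ x₀ : M, chartVolume (m := m) (n := n) f x₀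

/-- The component `h^⊥` normal to the immersion `f` of a vector `h` at `f x`: the orthogonal
projection to the orthogonal complement of `T_x f (T_x M)` in `T_{f x} N`. -/
def normalPart (f : Imm m n M N) (x : M) (h : TangentSpace (𝓡 n) (f x)) :
    TangentSpace (𝓡 n) (f x) :=
  (LinearMap.range (mfderiv (𝓡 m) (𝓡 n) f x).toLinearMap)ᗮ.starProjection h

/-- `G⁰_f(h, h) = ∫_M g(h, h) vol(f^*g)` for a vector field `h` along `f`. -/
def metricSq (f : Imm m n M N) (h : ∀ x : M, TangentSpace (𝓡 n) (f x)) : ENNReal :=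
  ∫⁻ x, ‖h x‖ₑ ^ 2 ∂(vol f)

/-- The horizontal length `∫₀¹ G⁰_γ(γ_t^⊥, γ_t^⊥)^{1/2} dt` of a path in `Imm(M, N)`. -/
def horizontalLength (γ : ℝ → Imm m n M N) : ENNReal :=
  ∫⁻ t in Set.Icc (0 : ℝ) 1,
    metricSq (γ t) (fun x => normalPart (γ t) x (velocity γ t x)) ^ (1 / 2 : ℝ)

/-- The geodesic distance on `B_i(M, N)` of the metric `G⁰`: the infimum of the horizontal lengths
of all smooth paths in `Imm(M, N)` from a lift of `F₀` to a lift of `F₁` (`⊤` if there is no such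
path). -/
def geodesicDist (F₀ F₁ : Bi m n M N) : ENNReal :=
  ⨅ (γ : ℝ → Imm m n M N) (_ : IsSmoothPath γ) (_ : proj (γ 0) = F₀) (_ : proj (γ 1) = F₁),
    horizontalLength γ

end Riemannian

end

end ShapeSpace

/-! The horizontal energy sees only the normal part of the velocity, and steep zigzags make that
part small at bounded cost in volume. Let an immersion move in a chart of `N` along the straight
path `F + σ(t) w e`, with a constant direction `e` transverse to `F`. The coordinate tangent vectors
are `a i + c i • e`, with `c i` equal to `σ(t)` times the `i`-th partial derivative of `w`, and the
velocity is `σ'(t) w e`. The volume density times the length of the normal part `e^⊥` is the square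
root of the Gram determinant of the `a i` together with `e`, so it does not depend on `c`
(`det_gram_mul_norm_starProjection_sq`). Moreover `|c i| ‖e^⊥‖ ≤ ‖a i‖`
(`abs_mul_norm_starProjection_le`). The energy density, which contains `‖e^⊥‖²`, therefore stays
bounded, and it is small wherever `w` is steep.

To go cheaply from `F` to `F + h e`, pass through `F + w e` with `w = h (1 + cos (k u_i)) / 2`. Both
`w` and `h - w` are steep for large `k`, except where `h` is small, where `sin (k u_i)` is small (a
set of small measure), or where `σ(t)` is small (a short time). This gives
`TransverseBump.indistinguishable`. Immersivity is never lost, since adding multiples of a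
transverse direction preserves transversality, however steep they are.

Since `m < n`, near each point there is a basis of directions transverse to a given immersion. A
partition of unity on the compact `M`, followed by a splitting into coordinates for these bases,
reduces every small deformation to finitely many such moves (`eventually_indistinguishable`). Being
joined by arbitrarily short deformations is an equivalence relation, so along a smooth path its
classes are open in time, and connectedness of the time line relates the two ends
(`IsSmoothPath.indistinguishable`). Thus the short path can be chosen with the same two ends in
`Imm` as the given path. -/

/-! ### Gram determinants and the height of a vector over a tilted span. -/

section GramDeterminant

open Matrix

variable {ι κ E : Type*} [Fintype ι] [Fintype κ] [NormedAddCommGroup E] [InnerProductSpace ℝ E]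

omit [Fintype ι] in
/-- Gram matrices transform by congruence under linear substitutions. -/
theorem gram_sum_smul (T : Matrix ι κ ℝ) (v : κ → E) :
    gram ℝ (fun i => ∑ j, T i j • v j) = T * gram ℝ v * Tᵀ := by
  ext i k
  simp only [gram_apply, Matrix.mul_apply, transpose_apply, sum_inner, inner_sum, inner_smul_left,
    inner_smul_right, Finset.sum_mul]
  refine Finset.sum_congr rfl fun a _ => ?_
  rw [Finset.mul_sum]
  refine Finset.sum_congr rfl fun b _ => ?_
  simp only [conj_trivial, real_inner_comm (v a) (v b)]
  ring

theorem det_gram_sum_smul [DecidableEq κ] (T : Matrix κ κ ℝ) (v : κ → E) :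
    (gram ℝ (fun i => ∑ j, T i j • v j)).det = T.det ^ 2 * (gram ℝ v).det := by
  rw [gram_sum_smul, det_mul, det_mul, det_transpose]; ring

variable [DecidableEq ι]

/-- Adding multiples of the last vector to the others does not change the Gram determinant. -/
theorem det_gram_add_smul_last (a : ι → E) (e : E) (c : ι → ℝ) :
    (gram ℝ (Sum.elim (fun i => a i + c i • e) (fun _ : Unit => e))).det =
      (gram ℝ (Sum.elim a (fun _ : Unit => e))).det := by
  have h := det_gram_sum_smul
    (fromBlocks (1 : Matrix ι ι ℝ) (of fun i _ => c i) 0 (1 : Matrix Unit Unit ℝ))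
    (Sum.elim a (fun _ : Unit => e))
  rw [det_fromBlocks_zero₂₁, det_one, det_one] at h
  rw [one_mul, one_pow, one_mul] at h
  rw [← h]
  congr 2
  ext i
  rcases i with i | i <;> simp [Fintype.sum_sum_type, Matrix.one_apply]

/-- Adding to the last vector a combination of the others does not change the Gram determinant. -/
theorem det_gram_add_sum_smul (a : ι → E) (e : E) (c : ι → ℝ) :
    (gram ℝ (Sum.elim a (fun _ : Unit => e + ∑ i, c i • a i))).det =
      (gram ℝ (Sum.elim a (fun _ : Unit => e))).det := by
  have h := det_gram_sum_smul
    (fromBlocks (1 : Matrix ι ι ℝ) 0 (of fun _ i => c i) (1 : Matrix Unit Unit ℝ))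
    (Sum.elim a (fun _ : Unit => e))
  rw [det_fromBlocks_zero₁₂, det_one, det_one] at h
  rw [one_mul, one_pow, one_mul] at h
  rw [← h]
  congr 2
  ext i
  rcases i with i | i <;> simp [Fintype.sum_sum_type, Matrix.one_apply, add_comm]

theorem det_gram_of_orthogonal (a : ι → E) (p : E) (h : ∀ i, inner ℝ (a i) p = 0) :
    (gram ℝ (Sum.elim a (fun _ : Unit => p))).det = (gram ℝ a).det * ‖p‖ ^ 2 := by
  have : gram ℝ (Sum.elim a (fun _ : Unit => p)) =
      fromBlocks (gram ℝ a) 0 0 (of fun _ _ => ‖p‖ ^ 2) := by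
    ext i j
    rcases i with i | i <;> rcases j with j | j <;>
      simp [h, fun i => (real_inner_comm (a i) p).trans (h i)]
  rw [this, det_fromBlocks_zero₂₁]
  simp

theorem det_gram_le (a : ι → E) {R : ℝ} (hR : ∀ i, ‖a i‖ ≤ R) :
    (gram ℝ a).det ≤ (Fintype.card ι).factorial * (R ^ 2) ^ Fintype.card ι := by
  have h := Matrix.det_le (A := gram ℝ a) (abv := AbsoluteValue.abs) (x := R ^ 2) (fun i j => by
    simp only [gram_apply, AbsoluteValue.abs_apply]
    refine (abs_real_inner_le_norm _ _).trans ?_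
    rw [sq]
    exact mul_le_mul (hR i) (hR j) (norm_nonneg _) ((norm_nonneg _).trans (hR i)))
  rw [nsmul_eq_mul] at h
  exact (le_abs_self _).trans h

variable [FiniteDimensional ℝ E] {a : ι → E} {e : E} {c : ι → ℝ} {S : Submodule ℝ E}

/-- Base times height. The projection `p` differs from `e` by a combination of the vectors `a i + c
i • e`, so replacing `e` by `p` keeps the determinant, and `p` splits off as an orthogonal block.
Then `c` is removed by subtracting multiples of `e`. The right-hand side is free of `c`. -/
theorem det_gram_mul_norm_starProjection_sq
    (hS : S = Submodule.span ℝ (Set.range fun i => a i + c i • e)) :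
    (gram ℝ (fun i => a i + c i • e)).det * ‖Sᗮ.starProjection e‖ ^ 2 =
      (gram ℝ (Sum.elim a (fun _ : Unit => e))).det := by
  set b : ι → E := fun i => a i + c i • e with hb
  set p := Sᗮ.starProjection e with hp
  have hpS : p ∈ Sᗮ := Submodule.starProjection_apply_mem _ _
  have hdiff : p - e ∈ S := by
    have h1 := Submodule.sub_starProjection_mem_orthogonal (K := Sᗮ) e
    rw [Submodule.orthogonal_orthogonal] at h1
    rw [← neg_sub]
    exact S.neg_mem h1
  rw [hS] at hdiff
  obtain ⟨d, hd⟩ := (Submodule.mem_span_range_iff_exists_fun ℝ).1 hdiff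
  have hpe : p = e + ∑ i, d i • b i := by rw [hd]; abel
  rw [← det_gram_of_orthogonal b p fun i => hpS _ (hS ▸ Submodule.subset_span ⟨i, rfl⟩), hpe,
    det_gram_add_sum_smul, det_gram_add_smul_last]

/-- The volume density of the span of the `a i + c i • e`, times the height of `e` over this span,
is bounded independently of `c`. -/
theorem sqrt_det_gram_mul_norm_starProjection_le
    (hS : S = Submodule.span ℝ (Set.range fun i => a i + c i • e)) {R : ℝ}
    (hR : ∀ i, ‖a i‖ ≤ R) (he : ‖e‖ ≤ R) :
    √(gram ℝ (fun i => a i + c i • e)).det * ‖Sᗮ.starProjection e‖ ≤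
      √((Fintype.card ι + 1).factorial * (R ^ 2) ^ (Fintype.card ι + 1)) := by
  have h := det_gram_mul_norm_starProjection_sq hS
  rw [← Real.sqrt_sq (norm_nonneg (Submodule.starProjection _ e)), ← Real.sqrt_mul', h]
  · refine Real.sqrt_le_sqrt ?_
    have := det_gram_le (Sum.elim a (fun _ : Unit => e)) (R := R) (by
      rintro (i | i)
      · exact hR i
      · exact he)
    simpa [Fintype.card_sum] using this
  · positivity

-- The projection kills `a i + c i • e`, so `c i` times the normal part of `e` is minus the normal
-- part of `a i`. A large slope `c i` thus forces `e` to be nearly tangent.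
omit [Fintype ι] [DecidableEq ι] in
theorem abs_mul_norm_starProjection_le
    (hS : S = Submodule.span ℝ (Set.range fun i => a i + c i • e)) (i : ι) :
    |c i| * ‖Sᗮ.starProjection e‖ ≤ ‖a i‖ := by
  have h0 : Sᗮ.starProjection (a i + c i • e) = 0 := by
    rw [Submodule.starProjection_apply_eq_zero_iff]
    exact Submodule.le_orthogonal_orthogonal _ (hS ▸ Submodule.subset_span ⟨i, rfl⟩)
  rw [map_add, map_smul] at h0
  rw [← Real.norm_eq_abs, ← norm_smul, eq_neg_of_add_eq_zero_right h0, norm_neg]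
  exact Submodule.norm_starProjection_apply_le _ _

end GramDeterminant

/-! ### Measure of the set where the oscillation is flat. -/

section OscillationMeasure

/-- Take the nearest multiple of `π` and apply Jordan's inequality `2/π |z| ≤ |sin z|` for `|z| ≤
π/2`. -/
theorem exists_int_abs_sub_mul_pi_le {y η : ℝ} (h : |Real.sin y| < η) :
    ∃ k : ℤ, |y - k * Real.pi| ≤ Real.pi / 2 * η ∧ |(k : ℝ)| ≤ |y| + 1 := by
  have hpi := Real.pi_pos
  have h1 : |y / Real.pi - round (y / Real.pi)| ≤ 1 / 2 := abs_sub_round _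
  have h3 : y - round (y / Real.pi) * Real.pi =
      (y / Real.pi - round (y / Real.pi)) * Real.pi := by field_simp
  have h2 : |y - round (y / Real.pi) * Real.pi| ≤ Real.pi / 2 := by
    rw [h3, abs_mul, abs_of_pos hpi]
    nlinarith
  refine ⟨round (y / Real.pi), ?_, ?_⟩
  · have h4 := Real.mul_abs_le_abs_sin h2
    rw [Real.sin_sub_int_mul_pi, abs_mul, abs_zpow, abs_neg, abs_one, one_zpow, one_mul] at h4
    have h5 : |y - round (y / Real.pi) * Real.pi| =
      Real.pi / 2 * (2 / Real.pi * |y - round (y / Real.pi) * Real.pi|) := by field_simp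
    rw [h5]
    gcongr
    exact h4.trans h.le
  · have h6 : |y / Real.pi| ≤ |y| := by
      rw [abs_div, abs_of_pos hpi]
      exact div_le_self (abs_nonneg _) (by linarith [Real.pi_gt_three])
    have h7 : (round (y / Real.pi) : ℝ) =
      y / Real.pi - (y / Real.pi - round (y / Real.pi)) := by ring
    rw [h7]
    refine (abs_sub _ _).trans ?_
    linarith

theorem volume_slab_le {m : ℕ} (i : Fin m) (R a r : ℝ) :
    volume {u : EuclideanSpace ℝ (Fin m) | (∀ j, |u j| ≤ R) ∧ |u i - a| ≤ r} ≤
      ENNReal.ofReal (2 * r) * ENNReal.ofReal (2 * R) ^ (m - 1) := by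
  classical
  set T : Set (Fin m → ℝ) :=
    Set.univ.pi (Function.update (fun _ => Set.Icc (-R) R) i (Set.Icc (a - r) (a + r))) with hT
  have hsub : {u : EuclideanSpace ℝ (Fin m) | (∀ j, |u j| ≤ R) ∧ |u i - a| ≤ r} ⊆
      WithLp.ofLp ⁻¹' T := by
    rintro u ⟨h1, h2⟩
    simp only [hT, Set.mem_preimage, Set.mem_univ_pi]
    intro j
    by_cases hj : j = i
    · subst hj
      have := abs_le.1 h2
      simp only [Function.update_self, Set.mem_Icc]
      constructor <;> linarith [this.1, this.2]
    · simp only [Function.update_of_ne hj, Set.mem_Icc]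
      exact abs_le.1 (h1 j)
  have hTm : MeasurableSet T := by
    refine MeasurableSet.univ_pi fun j => ?_
    by_cases hj : j = i
    · subst hj; simp
    · simp [Function.update_of_ne hj]
  refine (measure_mono hsub).trans ?_
  rw [(PiLp.volume_preserving_ofLp (Fin m)).measure_preimage hTm.nullMeasurableSet, hT,
    volume_pi_pi]
  rw [← Finset.mul_prod_erase _ _ (Finset.mem_univ i), Function.update_self, Real.volume_Icc]
  rw [Finset.prod_congr rfl (g := fun _ => ENNReal.ofReal (2 * R))]
  · simp only [Finset.prod_const, Finset.card_erase_of_mem (Finset.mem_univ i), Finset.card_univ,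
      Fintype.card_fin]
    gcongr
    linarith
  · intro j hj
    rw [Function.update_of_ne (Finset.ne_of_mem_erase hj), Real.volume_Icc]
    congr 1; ring

/-- The set where `|sin (n x_i)|` is small has small measure in bounded sets, uniformly in `n`. -/
theorem exists_volume_abs_sin_lt_le {m : ℕ} (i : Fin m) {L : Set (EuclideanSpace ℝ (Fin m))}
    (hL : Bornology.IsBounded L) {ε : ENNReal} (hε : 0 < ε) :
    ∃ η₀ : ℝ, 0 < η₀ ∧ ∀ η ≤ η₀, ∀ n : ℕ, 1 ≤ n →
      volume (L ∩ {u | |Real.sin (n * u i)| < η}) ≤ ε := by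
  obtain ⟨R₀, hR₀⟩ := hL.exists_norm_le
  obtain ⟨R, hR⟩ := exists_nat_ge R₀
  set V : ENNReal := ENNReal.ofReal (2 * R) ^ (m - 1) with hV
  have hVtop : V ≠ ⊤ := ENNReal.pow_ne_top ENNReal.ofReal_ne_top
  -- The set is covered by `2nR + 3` slabs of width `πη/n` in a box of half-side `R`. Since `n ≥ 1`,
  -- their total width is at most `(2R + 3)πη`, uniformly in `n`.
  have htend : Filter.Tendsto (fun η : ℝ => ENNReal.ofReal ((2 * R + 3) * (Real.pi * η)) * V)
      (nhds 0) (nhds (ENNReal.ofReal ((2 * R + 3) * (Real.pi * 0)) * V)) := by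
    refine ENNReal.Tendsto.mul_const ?_ (Or.inr hVtop)
    exact (ENNReal.continuous_ofReal.tendsto _).comp
      ((by fun_prop : Continuous fun η : ℝ => (2 * R + 3) * (Real.pi * η)).tendsto 0)
  rw [mul_zero, mul_zero, ENNReal.ofReal_zero, zero_mul] at htend
  obtain ⟨η, hη, hη0⟩ := (((htend.eventually_lt_const hε).filter_mono
    nhdsWithin_le_nhds).and self_mem_nhdsWithin : ∀ᶠ η in nhdsWithin (0 : ℝ) (Set.Ioi 0), _).exists
  refine ⟨η, hη0, fun η' hη' n hn => le_trans ?_ hη.le⟩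
  have hη0 : 0 < η := hη0
  have hn0 : (0 : ℝ) < n := by exact_mod_cast hn
  have hn1 : (1 : ℝ) ≤ n := by exact_mod_cast hn
  set N : ℤ := n * R + 1 with hN
  have hcover : L ∩ {u | |Real.sin (n * u i)| < η'} ⊆ ⋃ k ∈ Finset.Icc (-N) N,
      {u : EuclideanSpace ℝ (Fin m) | (∀ j, |u j| ≤ R) ∧
        |u i - k * Real.pi / n| ≤ Real.pi / 2 * η / n} := by
    rintro u ⟨huL, hu⟩
    have hb : ∀ j, |u j| ≤ R := fun j =>
      (PiLp.norm_apply_le u j).trans ((hR₀ u huL).trans hR)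
    obtain ⟨k, hk1, hk2⟩ := exists_int_abs_sub_mul_pi_le (lt_of_lt_of_le hu hη')
    simp only [Set.mem_iUnion]
    refine ⟨k, ?_, hb, ?_⟩
    · have : |(k : ℝ)| ≤ (N : ℝ) := by
        refine hk2.trans ?_
        rw [abs_mul, abs_of_pos hn0, hN]
        push_cast
        gcongr
        exact hb i
      have := abs_le.1 this
      rw [Finset.mem_Icc]
      exact_mod_cast this
    · have : u i - k * Real.pi / n = (n * u i - k * Real.pi) / n := by field_simp
      rw [this, abs_div, abs_of_pos hn0]
      gcongr
  refine (measure_mono hcover).trans ((measure_biUnion_finset_le _ _).trans ?_)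
  refine (Finset.sum_le_sum fun k _ => volume_slab_le i R _ _).trans ?_
  rw [Finset.sum_const, nsmul_eq_mul, ← hV, ← mul_assoc]
  gcongr
  have hcard : ((Finset.Icc (-N) N).card : ENNReal) = ENNReal.ofReal (2 * (n * R) + 3) := by
    rw [← ENNReal.ofReal_natCast]
    congr 1
    have hNnn : 0 ≤ N := by positivity
    rw [Int.card_Icc, ← Int.cast_natCast, Int.toNat_of_nonneg (by lia)]
    push_cast [hN]; ring
  rw [hcard, ← ENNReal.ofReal_mul (by positivity)]
  apply ENNReal.ofReal_le_ofReal
  have : (2 * (n * R) + 3) * (2 * (Real.pi / 2 * η / n)) =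
    ((2 * (n * R) + 3) / n) * (Real.pi * η) := by field_simp
  rw [this]
  gcongr
  rw [div_le_iff₀ hn0]
  nlinarith

end OscillationMeasure

namespace ShapeSpace

/-! ### Frames of the tangent bundle of `N` induced by charts. -/

section ChartFrames

variable {n : ℕ} {N : Type*}
  [TopologicalSpace N] [ChartedSpace (EuclideanSpace ℝ (Fin n)) N] [IsManifold (𝓡 n) ∞ N]

/-- The inverse at `y` of the differential of the preferred chart at `y₀`. -/
noncomputable def chartSymmL (y₀ y : N) : EuclideanSpace ℝ (Fin n) →L[ℝ] TangentSpace (𝓡 n) y :=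
  (trivializationAt (EuclideanSpace ℝ (Fin n)) (TangentSpace (𝓡 n)) y₀).symmL ℝ y

theorem chartSymmL_mfderiv_chart {y₀ y : N}
    (h : y ∈ (chartAt (EuclideanSpace ℝ (Fin n)) y₀).source) (v : TangentSpace (𝓡 n) y) :
    chartSymmL y₀ y (mfderiv (𝓡 n) (𝓡 n) (chartAt (EuclideanSpace ℝ (Fin n)) y₀) y v) = v := by
  have h1 := TangentBundle.continuousLinearMapAt_trivializationAt (I := 𝓡 n) h
  have h2 : (extChartAt (𝓡 n) y₀ : N → EuclideanSpace ℝ (Fin n)) =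
    chartAt (EuclideanSpace ℝ (Fin n)) y₀ := by
    ext; simp
  rw [h2] at h1
  have h3 := (trivializationAt (EuclideanSpace ℝ (Fin n)) (TangentSpace (𝓡 n))
    y₀).symmL_continuousLinearMapAt (R := ℝ) (b := y) (by simpa using h) v
  rw [h1] at h3
  exact h3

theorem mfderiv_eq_chartSymmL {E : Type*} [NormedAddCommGroup E] [NormedSpace ℝ E]
    {g : E → N} {u : E} (hg : MDifferentiableAt 𝓘(ℝ, E) (𝓡 n) g u) {y₀ : N}
    (h : g u ∈ (chartAt (EuclideanSpace ℝ (Fin n)) y₀).source) (v : E) :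
    mfderiv 𝓘(ℝ, E) (𝓡 n) g u v =
      chartSymmL y₀ (g u) (fderiv ℝ (chartAt (EuclideanSpace ℝ (Fin n)) y₀ ∘ g) u v) := by
  have h1 := mfderiv_comp_apply (I := 𝓘(ℝ, E)) (I' := 𝓡 n) (I'' := 𝓡 n) u
    ((mdifferentiable_chart y₀).mdifferentiableAt h) hg v
  rw [← mfderiv_eq_fderiv]
  exact (chartSymmL_mfderiv_chart h _).symm.trans (congrArg _ h1.symm)

variable [Bundle.RiemannianBundle (fun y : N => TangentSpace (𝓡 n) y)]
    [IsContMDiffRiemannianBundle (𝓡 n) ∞ (EuclideanSpace ℝ (Fin n))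
      (fun y : N => TangentSpace (𝓡 n) y)]

variable (n N) in
theorem isContinuousRiemannianBundle_tangentSpace :
    IsContinuousRiemannianBundle (EuclideanSpace ℝ (Fin n))
      (fun y : N => TangentSpace (𝓡 n) y) := by
  obtain ⟨g, hg, h⟩ := IsContMDiffRiemannianBundle.exists_contMDiff (IB := 𝓡 n) (n := ∞)
    (F := EuclideanSpace ℝ (Fin n)) (E := fun y : N => TangentSpace (𝓡 n) y)
  exact ⟨g, hg.continuous, h⟩

/-- Local comparison of the Riemannian norm with the Euclidean norm of the chart. The regularity of
the metric enters the proof only here. -/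
theorem eventually_norm_chartSymmL_le (y₀ : N) :
    ∃ C > 0, ∀ᶠ y in nhds y₀, ∀ v, ‖chartSymmL (n := n) y₀ y v‖ ≤ C * ‖v‖ := by
  have := isContinuousRiemannianBundle_tangentSpace n N
  obtain ⟨C, hC, h⟩ := eventually_norm_symmL_trivializationAt_lt (EuclideanSpace ℝ (Fin n))
    (fun y : N => TangentSpace (𝓡 n) y) y₀
  refine ⟨C, hC, h.mono fun y hy v => ?_⟩
  exact (ContinuousLinearMap.le_opNorm _ _).trans
    (mul_le_mul_of_nonneg_right hy.le (norm_nonneg _))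

end ChartFrames

/-! ### The volume density in charts. -/

section VolumeDensity

open Matrix

variable {m n : ℕ} {M N : Type*}
  [TopologicalSpace M] [ChartedSpace (EuclideanSpace ℝ (Fin m)) M] [IsManifold (𝓡 m) ∞ M]
  [TopologicalSpace N] [ChartedSpace (EuclideanSpace ℝ (Fin n)) N] [IsManifold (𝓡 n) ∞ N]
  [Bundle.RiemannianBundle (fun y : N => TangentSpace (𝓡 n) y)]

/-- Change of coordinates for the matrix of the pulled back metric. -/
theorem pullbackMatrix_comp_chart {f : M → N} (hf : ContMDiff (𝓡 m) (𝓡 n) ∞ f) (x₀ x₁ : M)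
    {u : EuclideanSpace ℝ (Fin m)}
    (hu : u ∈ ((chartAt (EuclideanSpace ℝ (Fin m)) x₁).symm.trans
      (chartAt (EuclideanSpace ℝ (Fin m)) x₀)).source) :
    (pullbackMatrix (m := m) (n := n) f x₁ u).det =
      (fderiv ℝ ((chartAt (EuclideanSpace ℝ (Fin m)) x₁).symm.trans
        (chartAt (EuclideanSpace ℝ (Fin m)) x₀)) u).det ^ 2 *
      (pullbackMatrix (m := m) (n := n) f x₀ ((chartAt (EuclideanSpace ℝ (Fin m)) x₁).symm.trans
        (chartAt (EuclideanSpace ℝ (Fin m)) x₀) u)).det := by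
  set φ₀ := chartAt (EuclideanSpace ℝ (Fin m)) x₀ with hφ₀
  set φ₁ := chartAt (EuclideanSpace ℝ (Fin m)) x₁ with hφ₁
  set τ := φ₁.symm.trans φ₀ with hτ
  have hu1 : u ∈ φ₁.target := by
    have := hu; simp only [hτ, mfld_simps] at this; exact this.1
  have hu2 : φ₁.symm u ∈ φ₀.source := by
    have := hu; simp only [hτ, mfld_simps] at this; exact this.2
  have hτu : τ u = φ₀ (φ₁.symm u) := rfl
  have hu3 : τ u ∈ φ₀.target := φ₀.map_source hu2
  have hpt : (f ∘ φ₁.symm) u = (f ∘ φ₀.symm) (τ u) := by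
    simp only [Function.comp, hτu, φ₀.left_inv hu2]
  have hd1 : MDifferentiableAt (𝓡 m) (𝓡 m) φ₁.symm u :=
    (mdifferentiable_chart x₁).mdifferentiableAt_symm hu1
  have hd0 : MDifferentiableAt (𝓡 m) (𝓡 m) φ₀.symm (τ u) :=
    (mdifferentiable_chart x₀).mdifferentiableAt_symm hu3
  have hfd : MDifferentiable (𝓡 m) (𝓡 n) f := hf.mdifferentiable (by simp)
  have hg1 : MDifferentiableAt (𝓡 m) (𝓡 n) (f ∘ φ₁.symm) u := (hfd _).comp u hd1
  have hg0 : MDifferentiableAt (𝓡 m) (𝓡 n) (f ∘ φ₀.symm) (τ u) := (hfd _).comp _ hd0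
  set y₀ := (f ∘ φ₀.symm) (τ u) with hy₀
  set ψ := chartAt (EuclideanSpace ℝ (Fin n)) y₀ with hψ
  have hsrc : (f ∘ φ₀.symm) (τ u) ∈ ψ.source := mem_chart_source _ _
  have hτd : DifferentiableAt ℝ τ u := by
    rw [← mdifferentiableAt_iff_differentiableAt]
    exact ((mdifferentiable_chart x₀).mdifferentiableAt hu2).comp u hd1
  have hψg : DifferentiableAt ℝ (ψ ∘ (f ∘ φ₀.symm)) (τ u) := by
    rw [← mdifferentiableAt_iff_differentiableAt]
    exact ((mdifferentiable_chart y₀).mdifferentiableAt hsrc).comp _ hg0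
  set D := fderiv ℝ (ψ ∘ (f ∘ φ₀.symm)) (τ u) with hD
  set T := fderiv ℝ τ u with hT
  have hchain : fderiv ℝ (ψ ∘ (f ∘ φ₁.symm)) u = D.comp T := by
    rw [hD, hT, ← fderiv_comp u hψg hτd]
    refine Filter.EventuallyEq.fderiv_eq ?_
    filter_upwards [τ.open_source.mem_nhds hu] with v hv
    have hv2 : φ₁.symm v ∈ φ₀.source := by
      have := hv; simp only [hτ, mfld_simps] at this; exact this.2
    have : τ v = φ₀ (φ₁.symm v) := rfl
    simp only [Function.comp, this, φ₀.left_inv hv2]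
  -- The two coordinate expressions have base points that are equal but not definitionally so.
  -- Keeping the base point as a variable `y` allows rewriting across the different tangent spaces.
  set G : N → Matrix (Fin m) (Fin m) ℝ := fun y => gram ℝ fun i : Fin m =>
    chartSymmL y₀ y (D (T (EuclideanSpace.single i (1 : ℝ)))) with hG
  have hL : pullbackMatrix (m := m) (n := n) f x₁ u = G y₀ := by
    rw [← hpt, hG]
    unfold pullbackMatrix
    congr 1
    funext i
    have h := mfderiv_eq_chartSymmL hg1 (y₀ := y₀) (by rw [hpt]; exact hsrc)
      (EuclideanSpace.single i (1 : ℝ))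
    rw [hchain] at h
    exact h
  have hR : pullbackMatrix (m := m) (n := n) f x₀ (τ u) = gram ℝ fun i : Fin m =>
      chartSymmL y₀ y₀ (D (EuclideanSpace.single i (1 : ℝ))) := by
    unfold pullbackMatrix
    congr 1
    funext i
    exact mfderiv_eq_chartSymmL hg0 hsrc _
  rw [hL, hR]
  set b := (EuclideanSpace.basisFun (Fin m) ℝ).toBasis with hb
  have hsum : ∀ v : EuclideanSpace ℝ (Fin m), v = ∑ k, v k • EuclideanSpace.single k (1 : ℝ) := by
    intro v
    ext j
    simp [Pi.single_apply]
  have hG0 : G y₀ = gram ℝ fun i : Fin m => ∑ k, ((LinearMap.toMatrix b b T.toLinearMap)ᵀ) i k •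
      chartSymmL y₀ y₀ (D (EuclideanSpace.single k (1 : ℝ))) := by
    simp only [hG]
    congr 1
    funext i
    rw [congrArg (fun w => chartSymmL y₀ y₀ (D w)) (hsum (T (EuclideanSpace.single i (1 : ℝ))))]
    simp only [map_sum, map_smul]
    refine Finset.sum_congr rfl fun k _ => ?_
    congr 1
  rw [hG0, det_gram_sum_smul, det_transpose, LinearMap.det_toMatrix]

/-- This inequality needs no measurability of `f` or `g`: it is checked on simple functions below
`g`. Hence the energy densities need not be shown measurable. -/
theorem lintegral_withDensity_le {α : Type*} [MeasurableSpace α] (μ : Measure α)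
    (f g : α → ENNReal) : ∫⁻ a, g a ∂(μ.withDensity f) ≤ ∫⁻ a, f a * g a ∂μ := by
  rw [lintegral]
  refine iSup₂_le fun s hs => ?_
  rw [SimpleFunc.lintegral]
  calc ∑ x ∈ s.range, x * μ.withDensity f (s ⁻¹' {x})
      ≤ ∑ x ∈ s.range, ∫⁻ a in s ⁻¹' {x}, f a * g a ∂μ := by
        refine Finset.sum_le_sum fun x _ => ?_
        rw [withDensity_apply _ (s.measurableSet_fiber x)]
        refine (lintegral_const_mul_le _ _).trans ?_
        refine setLIntegral_mono' (s.measurableSet_fiber x) fun a ha => ?_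
        rw [mul_comm]
        have : s a = x := ha
        gcongr
        exact this ▸ hs a
    _ = ∫⁻ a in ⋃ x ∈ s.range, s ⁻¹' {x}, f a * g a ∂μ := by
        rw [lintegral_biUnion_finset _ (fun x _ => s.measurableSet_fiber x)]
        intro x _ y _ hxy
        exact Disjoint.preimage _ (by simpa using hxy)
    _ ≤ ∫⁻ a, f a * g a ∂μ := setLIntegral_le_lintegral _ _

variable [MeasurableSpace M] [BorelSpace M]

omit [IsManifold (𝓡 m) ∞ M] in
theorem measurableSet_chart_target_inter (x₀ : M) {B : Set M} (hB : MeasurableSet B) :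
    MeasurableSet ((chartAt (EuclideanSpace ℝ (Fin m)) x₀).target ∩
      (chartAt (EuclideanSpace ℝ (Fin m)) x₀).symm ⁻¹' B) := by
  set φ := chartAt (EuclideanSpace ℝ (Fin m)) x₀ with hφ
  have h := (continuousOn_iff_continuous_domRestrict.1 φ.continuousOn_symm).measurable hB
  have h2 := φ.open_target.measurableSet.subtype_image h
  convert h2 using 1
  ext u
  simp [and_comm]

omit [IsManifold (𝓡 m) ∞ M] [IsManifold (𝓡 n) ∞ N] in
theorem chartVolume_apply (f : M → N) (x₀ : M) {B : Set M} (hB : MeasurableSet B) :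
    chartVolume (m := m) (n := n) f x₀ B =
      ∫⁻ u in (chartAt (EuclideanSpace ℝ (Fin m)) x₀).target ∩
          (chartAt (EuclideanSpace ℝ (Fin m)) x₀).symm ⁻¹' B,
        ENNReal.ofReal (√(pullbackMatrix (m := m) (n := n) f x₀ u).det) := by
  set φ := chartAt (EuclideanSpace ℝ (Fin m)) x₀ with hφ
  have hφm : AEMeasurable φ.symm (volume.restrict φ.target) :=
    φ.continuousOn_symm.aemeasurable φ.open_target.measurableSet
  unfold chartVolume
  rw [Measure.map_apply_of_aemeasurable (hφm.mono_ac (withDensity_absolutelyContinuous _ _)) hB]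
  have h0 : NullMeasurableSet (φ.symm ⁻¹' B) (volume.restrict φ.target) :=
    hφm.nullMeasurableSet_preimage hB
  rw [withDensity_apply' , Measure.restrict_restrict₀ h0, Set.inter_comm]

/-- Change of variables along the transition map, whose Jacobian is exactly the factor by which the
roots of the Gram determinants differ. An inequality suffices, since only upper bounds of energies
are used. -/
theorem chartVolume_restrict_le {f : M → N} (hf : ContMDiff (𝓡 m) (𝓡 n) ∞ f) (x₀ x₁ : M) :
    (chartVolume (m := m) (n := n) f x₁).restrict
        (chartAt (EuclideanSpace ℝ (Fin m)) x₀).source ≤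
      chartVolume (m := m) (n := n) f x₀ := by
  refine Measure.le_iff.2 fun B hB => ?_
  have hS : MeasurableSet (chartAt (EuclideanSpace ℝ (Fin m)) x₀).source :=
    (chartAt (EuclideanSpace ℝ (Fin m)) x₀).open_source.measurableSet
  rw [Measure.restrict_apply hB, chartVolume_apply f x₀ hB, chartVolume_apply f x₁ (hB.inter hS)]
  set φ₀ := chartAt (EuclideanSpace ℝ (Fin m)) x₀ with hφ₀
  set φ₁ := chartAt (EuclideanSpace ℝ (Fin m)) x₁ with hφ₁
  set τ := φ₁.symm.trans φ₀ with hτ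
  set A := φ₁.target ∩ φ₁.symm ⁻¹' (B ∩ φ₀.source) with hA
  have hAτ : A ⊆ τ.source := by
    rintro u ⟨h1, h2⟩
    simp only [hτ, mfld_simps]
    exact ⟨h1, h2.2⟩
  have hAm : MeasurableSet A := measurableSet_chart_target_inter x₁ (hB.inter hS)
  have himage : τ '' A ⊆ φ₀.target ∩ φ₀.symm ⁻¹' B := by
    rintro _ ⟨u, ⟨h1, h2⟩, rfl⟩
    have h3 : φ₀.symm (φ₀ (φ₁.symm u)) = φ₁.symm u := φ₀.left_inv h2.2
    refine ⟨φ₀.map_source h2.2, ?_⟩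
    change φ₀.symm (φ₀ (φ₁.symm u)) ∈ B
    rw [h3]; exact h2.1
  have hτd : ∀ u ∈ A, HasFDerivWithinAt τ (fderiv ℝ τ u) A u := by
    intro u hu
    have h1 : MDifferentiableAt (𝓡 m) (𝓡 m) τ u :=
      ((mdifferentiable_chart x₀).mdifferentiableAt hu.2.2).comp u
        ((mdifferentiable_chart x₁).mdifferentiableAt_symm hu.1)
    exact (mdifferentiableAt_iff_differentiableAt.1 h1).hasFDerivAt.hasFDerivWithinAt
  calc ∫⁻ u in A, ENNReal.ofReal (√(pullbackMatrix (m := m) (n := n) f x₁ u).det)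
      = ∫⁻ u in A, ENNReal.ofReal |(fderiv ℝ τ u).det| *
          ENNReal.ofReal (√(pullbackMatrix (m := m) (n := n) f x₀ (τ u)).det) := by
        refine setLIntegral_congr_fun hAm fun u hu => ?_
        rw [← ENNReal.ofReal_mul (abs_nonneg _)]
        rw [pullbackMatrix_comp_chart hf x₀ x₁ (hAτ hu), Real.sqrt_mul (sq_nonneg _),
          Real.sqrt_sq_eq_abs]
    _ = ∫⁻ u in τ '' A, ENNReal.ofReal (√(pullbackMatrix (m := m) (n := n) f x₀ u).det) :=
        (lintegral_image_eq_lintegral_abs_det_fderiv_mul volume hAm hτd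
          (τ.injOn.mono hAτ) fun u =>
            ENNReal.ofReal (√(pullbackMatrix (m := m) (n := n) f x₀ u).det)).symm
    _ ≤ _ := lintegral_mono_set himage

/-- A bound on a supremum of measures must hold for each member. Each chart volume is split into its
part on the chart domain `S`, controlled by the transition formula, and its part off `S`, controlled
by `vol f` itself. Restriction to `S` then removes the second term. -/
theorem vol_restrict_chart_source_le (f : Imm m n M N) (x₀ : M) :
    (vol f).restrict (chartAt (EuclideanSpace ℝ (Fin m)) x₀).source ≤
      chartVolume (m := m) (n := n) f x₀ := by
  set S := (chartAt (EuclideanSpace ℝ (Fin m)) x₀).source with hS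
  have hSm : MeasurableSet S := (chartAt (EuclideanSpace ℝ (Fin m)) x₀).open_source.measurableSet
  have h : vol f ≤ chartVolume (m := m) (n := n) f x₀ + (vol f).restrict Sᶜ := by
    refine iSup_le fun x₁ => ?_
    rw [← Measure.restrict_add_restrict_compl (μ := chartVolume (m := m) (n := n) f x₁) hSm]
    refine add_le_add (chartVolume_restrict_le f.smooth x₀ x₁) (Measure.restrict_mono le_rfl ?_)
    exact le_iSup (fun x₁ : M => chartVolume (m := m) (n := n) f x₁) x₁
  refine (Measure.restrict_mono le_rfl h).trans ?_
  rw [Measure.restrict_add, Measure.restrict_restrict hSm, Set.inter_compl_self,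
    Measure.restrict_empty, add_zero]
  exact Measure.restrict_le_self

/-- Upper bound for integrals over a chart domain with respect to the volume density. -/
theorem lintegral_vol_le (f : Imm m n M N) (x₀ : M) (F : M → ENNReal)
    (hF : ∀ x ∉ (chartAt (EuclideanSpace ℝ (Fin m)) x₀).source, F x = 0) :
    ∫⁻ x, F x ∂(vol f) ≤ ∫⁻ u in (chartAt (EuclideanSpace ℝ (Fin m)) x₀).target,
      ENNReal.ofReal (√(pullbackMatrix (m := m) (n := n) f x₀ u).det) *
        F ((chartAt (EuclideanSpace ℝ (Fin m)) x₀).symm u) := by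
  have hSm : MeasurableSet (chartAt (EuclideanSpace ℝ (Fin m)) x₀).source :=
    (chartAt (EuclideanSpace ℝ (Fin m)) x₀).open_source.measurableSet
  rw [← lintegral_add_compl F hSm, setLIntegral_congr_fun hSm.compl (g := fun _ => 0) hF,
    lintegral_zero, add_zero]
  refine (lintegral_mono' (vol_restrict_chart_source_le f x₀) le_rfl).trans ?_
  exact (lintegral_map_le _ _).trans (lintegral_withDensity_le _ _ _)

end VolumeDensity

/-! ### Deformations that rest near both ends, and their concatenation. -/

section Deformations

variable {m n : ℕ} {M N : Type*}
  [TopologicalSpace M] [ChartedSpace (EuclideanSpace ℝ (Fin m)) M]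
  [TopologicalSpace N] [ChartedSpace (EuclideanSpace ℝ (Fin n)) N]

theorem Imm.ext {f g : Imm m n M N} (h : ∀ x, f x = g x) : f = g := by
  cases f; cases g
  congr
  exact funext h

/-- A smooth path of immersions, defined for all times, which is constantly `f` up to time `0` and
constantly `g` from time `1` on. -/
structure IsDeformation (γ : ℝ → Imm m n M N) (f g : Imm m n M N) : Prop where
  contMDiff : ContMDiff (𝓘(ℝ, ℝ).prod (𝓡 m)) (𝓡 n) ∞ (fun p : ℝ × M => γ p.1 p.2)
  eq_left : ∀ t ≤ 0, γ t = f
  eq_right : ∀ t, 1 ≤ t → γ t = g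

theorem IsDeformation.isSmoothPath {γ : ℝ → Imm m n M N} {f g : Imm m n M N}
    (h : IsDeformation γ f g) : IsSmoothPath γ :=
  h.contMDiff.contMDiffOn

theorem isDeformation_const (f : Imm m n M N) : IsDeformation (fun _ => f) f f where
  contMDiff := f.smooth.comp contMDiff_snd
  eq_left _ _ := rfl
  eq_right _ _ := rfl

theorem IsDeformation.reverse {γ : ℝ → Imm m n M N} {f g : Imm m n M N}
    (h : IsDeformation γ f g) : IsDeformation (fun t => γ (-1 * t + 1)) g f where
  contMDiff := by
    have h1 : ContMDiff 𝓘(ℝ, ℝ) 𝓘(ℝ, ℝ) ∞ (fun t : ℝ => -1 * t + 1) := by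
      rw [contMDiff_iff_contDiff]; fun_prop
    exact h.contMDiff.comp ((h1.comp contMDiff_fst).prodMk contMDiff_snd)
  eq_left t ht := h.eq_right _ (by linarith)
  eq_right t ht := h.eq_left _ (by linarith)

open Classical in
/-- Concatenation of deformations. -/
noncomputable def concat (γ₁ γ₂ : ℝ → Imm m n M N) (t : ℝ) : Imm m n M N :=
  -- Both pieces run at triple speed, the first ending at `1/3` and the second starting at `2/3`.
  -- The path is at rest on the middle third, so the switch at `1/2` is smooth. The summand `+ 0`
  -- matches the affine form `a * s + b` of the reparametrization lemmas.
  if t < 1 / 2 then γ₁ (3 * t + 0) else γ₂ (3 * t + -2)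

theorem concat_eventuallyEq_left (γ₁ γ₂ : ℝ → Imm m n M N) {t : ℝ} (ht : t < 1 / 2) :
    concat γ₁ γ₂ =ᶠ[nhds t] fun s => γ₁ (3 * s + 0) := by
  filter_upwards [Iio_mem_nhds ht] with s hs
  exact if_pos hs

theorem IsDeformation.concat_eventuallyEq_right {γ₁ γ₂ : ℝ → Imm m n M N} {f g h : Imm m n M N}
    (h₁ : IsDeformation γ₁ f g) (h₂ : IsDeformation γ₂ g h) {t : ℝ} (ht : 1 / 3 < t) :
    concat γ₁ γ₂ =ᶠ[nhds t] fun s => γ₂ (3 * s + -2) := by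
  filter_upwards [Ioi_mem_nhds ht] with s hs
  have hs : 1 / 3 < s := hs
  unfold concat
  split_ifs with h
  · rw [h₁.eq_right _ (by linarith), h₂.eq_left _ (by linarith)]
  · rfl

theorem IsDeformation.concat {γ₁ γ₂ : ℝ → Imm m n M N} {f g h : Imm m n M N}
    (h₁ : IsDeformation γ₁ f g) (h₂ : IsDeformation γ₂ g h) :
    IsDeformation (concat γ₁ γ₂) f h where
  contMDiff := by
    have haff : ∀ a b : ℝ, ContMDiff (𝓘(ℝ, ℝ).prod (𝓡 m)) (𝓘(ℝ, ℝ).prod (𝓡 m)) ∞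
        (fun p : ℝ × M => (a * p.1 + b, p.2)) := fun a b => by
      have h1 : ContMDiff 𝓘(ℝ, ℝ) 𝓘(ℝ, ℝ) ∞ (fun t : ℝ => a * t + b) := by
        rw [contMDiff_iff_contDiff]; fun_prop
      exact (h1.comp contMDiff_fst).prodMk contMDiff_snd
    rintro ⟨t, x⟩
    rcases lt_or_ge t (1 / 2) with ht | ht
    · refine ((h₁.contMDiff.comp (haff 3 0)).contMDiffAt (x := (t, x))).congr_of_eventuallyEq ?_
      filter_upwards [continuousAt_fst.eventually (concat_eventuallyEq_left γ₁ γ₂ ht)] with p hp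
      rw [hp]; rfl
    · refine ((h₂.contMDiff.comp (haff 3 (-2))).contMDiffAt (x := (t, x))).congr_of_eventuallyEq ?_
      filter_upwards [continuousAt_fst.eventually
        (h₁.concat_eventuallyEq_right h₂ (t := t) (by linarith))] with p hp
      rw [hp]; rfl
  eq_left t ht := by
    rw [(concat_eventuallyEq_left γ₁ γ₂ (t := t) (by linarith)).self_of_nhds]
    exact h₁.eq_left _ (by linarith)
  eq_right t ht := by
    rw [(h₁.concat_eventuallyEq_right h₂ (t := t) (by linarith)).self_of_nhds]
    exact h₂.eq_right _ (by linarith)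

end Deformations

/-! ### Horizontal length under reparametrization, and the indistinguishability relation. -/

section HorizontalLength

variable {m n : ℕ} {M N : Type*}
  [TopologicalSpace M] [ChartedSpace (EuclideanSpace ℝ (Fin m)) M]
  [TopologicalSpace N] [ChartedSpace (EuclideanSpace ℝ (Fin n)) N]
  [Bundle.RiemannianBundle (fun y : N => TangentSpace (𝓡 n) y)]
  [MeasurableSpace M]

/-- The norm of the normal part of a vector field along `f` whose values are given as elements of
the model space. -/
noncomputable def normalNorm (f : Imm m n M N) (v : M → EuclideanSpace ℝ (Fin n)) : ENNReal :=
  metricSq f (fun x => normalPart f x (v x)) ^ (1 / 2 : ℝ)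

/-- The horizontal speed at time `t` of a path of immersions defined near `t`. -/
noncomputable def horizontalSpeed (γ : ℝ → Imm m n M N) (t : ℝ) : ENNReal :=
  normalNorm (γ t) fun x => (mfderiv 𝓘(ℝ, ℝ) (𝓡 n) (fun s => γ s x) t :
    ℝ →L[ℝ] EuclideanSpace ℝ (Fin n)) (1 : ℝ)

theorem horizontalSpeed_congr {γ γ' : ℝ → Imm m n M N} {t : ℝ} (h : γ =ᶠ[nhds t] γ') :
    horizontalSpeed γ t = horizontalSpeed γ' t := by
  unfold horizontalSpeed
  rw [h.self_of_nhds]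
  congr 1
  funext x
  congr 1
  have : (fun s => γ s x) =ᶠ[nhds t] fun s => γ' s x := h.mono fun s hs => by
    simp only [hs]
  exact this.mfderiv_eq

theorem normalNorm_smul (f : Imm m n M N) (a : ℝ) (v : M → EuclideanSpace ℝ (Fin n)) :
    normalNorm f (fun x => a • v x) = ENNReal.ofReal |a| * normalNorm f v := by
  have h : ∀ x, ‖normalPart f x (a • v x : EuclideanSpace ℝ (Fin n))‖ₑ ^ 2 =
      ENNReal.ofReal |a| ^ 2 * ‖normalPart f x (v x)‖ₑ ^ 2 := by
    intro x
    have h1 : normalPart f x (a • v x : EuclideanSpace ℝ (Fin n)) = a • normalPart f x (v x) :=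
      map_smul _ _ _
    rw [h1, enorm_smul, mul_pow, Real.enorm_eq_ofReal_abs]
  unfold normalNorm metricSq
  simp only [h]
  rw [lintegral_const_mul' _ _ (by finiteness), ENNReal.mul_rpow_of_nonneg _ _ (by norm_num),
    ← ENNReal.rpow_natCast, ← ENNReal.rpow_mul]
  norm_num

theorem normalNorm_zero (f : Imm m n M N) : normalNorm f (fun _ => 0) = 0 := by
  have := normalNorm_smul f 0 (fun _ => 0)
  simpa using this

theorem horizontalSpeed_const (f : Imm m n M N) (t : ℝ) : horizontalSpeed (fun _ => f) t = 0 := by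
  unfold horizontalSpeed
  rw [← normalNorm_zero f]
  congr 1
  funext x
  have : mfderiv 𝓘(ℝ, ℝ) (𝓡 n) (fun _ : ℝ => f x) t = 0 := mfderiv_const
  rw [this]; rfl

omit [Bundle.RiemannianBundle fun y : N => TangentSpace (𝓡 n) y] [MeasurableSpace M] in
theorem IsDeformation.mdifferentiableAt {γ : ℝ → Imm m n M N} {f g : Imm m n M N}
    (h : IsDeformation γ f g) (x : M) (t : ℝ) :
    MDifferentiableAt 𝓘(ℝ, ℝ) (𝓡 n) (fun s => γ s x) t := by
  have h1 : ContMDiff 𝓘(ℝ, ℝ) (𝓡 n) ∞ (fun s : ℝ => γ s x) :=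
    h.contMDiff.comp (contMDiff_id.prodMk contMDiff_const)
  exact h1.mdifferentiable (by simp) t

theorem IsDeformation.horizontalSpeed_affine {γ : ℝ → Imm m n M N} {f g : Imm m n M N}
    (h : IsDeformation γ f g) (a b t : ℝ) :
    horizontalSpeed (fun s => γ (a * s + b)) t =
      ENNReal.ofReal |a| * horizontalSpeed γ (a * t + b) := by
  refine Eq.trans ?_ (normalNorm_smul _ _ _)
  unfold horizontalSpeed
  congr 1
  funext x
  have h1 : HasDerivAt (fun s : ℝ => a * s + b) a t := by
    simpa using ((hasDerivAt_id t).const_mul a).add_const b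
  have h2 := mfderiv_comp_apply (I := 𝓘(ℝ, ℝ)) (I' := 𝓘(ℝ, ℝ)) (I'' := 𝓡 n) t
    (h.mdifferentiableAt x (a * t + b)) (f := fun s : ℝ => a * s + b)
    h1.differentiableAt.mdifferentiableAt (1 : ℝ)
  have h3 : mfderiv 𝓘(ℝ, ℝ) 𝓘(ℝ, ℝ) (fun s : ℝ => a * s + b) t (1 : ℝ) = a • (1 : ℝ) := by
    have h4 : fderiv ℝ (fun s : ℝ => a * s + b) t (1 : ℝ) = a • (1 : ℝ) := by
      rw [h1.hasFDerivAt.fderiv]; simp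
    rw [mfderiv_eq_fderiv]
    exact h4
  refine h2.trans ?_
  rw [h3]
  exact map_smul _ _ _

/-- The endpoints are a null set, and at interior times the derivative within `[0, 1]` is the
ordinary one. -/
theorem horizontalLength_eq_setLIntegral (γ : ℝ → Imm m n M N) :
    horizontalLength γ = ∫⁻ t in Set.Ioo (0 : ℝ) 1, horizontalSpeed γ t := by
  unfold horizontalLength
  rw [setLIntegral_congr Ioo_ae_eq_Icc.symm]
  refine setLIntegral_congr_fun measurableSet_Ioo fun t ht => ?_
  have h1 : ∀ x, velocity γ t x = mfderiv 𝓘(ℝ, ℝ) (𝓡 n) (fun s => γ s x) t (1 : ℝ) := by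
    intro x
    unfold velocity
    rw [mfderivWithin_of_mem_nhds (Icc_mem_nhds ht.1 ht.2)]
  simp only [h1]
  rfl

/-- A deformation is locally constant before time `0` and after time `1`. Integrating over the whole
line makes affine substitutions free of boundary bookkeeping. -/
theorem IsDeformation.horizontalLength_eq {γ : ℝ → Imm m n M N} {f g : Imm m n M N}
    (h : IsDeformation γ f g) : horizontalLength γ = ∫⁻ t, horizontalSpeed γ t := by
  have h0 : ∀ t ∉ Set.Icc (0 : ℝ) 1, horizontalSpeed γ t = 0 := by
    intro t ht
    rw [Set.mem_Icc, not_and_or, not_le, not_le] at ht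
    rcases ht with ht | ht
    · rw [horizontalSpeed_congr (γ' := fun _ => f), horizontalSpeed_const]
      filter_upwards [Iio_mem_nhds ht] with s hs using h.eq_left s hs.le
    · rw [horizontalSpeed_congr (γ' := fun _ => g), horizontalSpeed_const]
      filter_upwards [Ioi_mem_nhds ht] with s hs using h.eq_right s hs.le
  have hsplit := lintegral_add_compl (μ := volume) (fun t => horizontalSpeed γ t)
    (measurableSet_Icc (a := (0 : ℝ)) (b := 1))
  rwa [setLIntegral_congr_fun measurableSet_Icc.compl (g := fun _ => 0) h0,
    lintegral_zero, add_zero, ← setLIntegral_congr Ioo_ae_eq_Icc,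
    ← horizontalLength_eq_setLIntegral] at hsplit

theorem IsDeformation.lintegral_horizontalSpeed_affine {γ : ℝ → Imm m n M N} {f g : Imm m n M N}
    (h : IsDeformation γ f g) {a : ℝ} (ha : a ≠ 0) (b : ℝ) :
    ∫⁻ t, horizontalSpeed (fun s => γ (a * s + b)) t = horizontalLength γ := by
  rw [h.horizontalLength_eq]
  simp only [h.horizontalSpeed_affine]
  have h1 := lintegral_image_eq_lintegral_abs_deriv_mul (s := Set.univ) (f := fun t => a * t + b)
    (f' := fun _ => a) MeasurableSet.univ
    (fun t _ => HasDerivAt.hasDerivWithinAt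
      (by simpa using ((hasDerivAt_id t).const_mul a).add_const b))
    (fun t _ s _ hts => by simpa [ha] using hts) (horizontalSpeed γ)
  have h2 : (fun t => a * t + b) '' Set.univ = Set.univ := by
    rw [Set.image_univ]
    exact Set.range_eq_univ.2 fun s => ⟨(s - b) / a, by field_simp; ring⟩
  rw [h2] at h1
  simpa using h1.symm

theorem IsDeformation.horizontalLength_reverse {γ : ℝ → Imm m n M N} {f g : Imm m n M N}
    (h : IsDeformation γ f g) : horizontalLength (fun t => γ (-1 * t + 1)) = horizontalLength γ := by
  rw [h.reverse.horizontalLength_eq, h.lintegral_horizontalSpeed_affine (by norm_num)]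

theorem IsDeformation.horizontalLength_concat_le {γ₁ γ₂ : ℝ → Imm m n M N} {f g h : Imm m n M N}
    (h₁ : IsDeformation γ₁ f g) (h₂ : IsDeformation γ₂ g h) :
    horizontalLength (ShapeSpace.concat γ₁ γ₂) ≤ horizontalLength γ₁ + horizontalLength γ₂ := by
  rw [(h₁.concat h₂).horizontalLength_eq, ← lintegral_add_compl _ (measurableSet_Iio (a := 1 / 2)),
    ← h₁.lintegral_horizontalSpeed_affine (a := 3) (by norm_num) 0,
    ← h₂.lintegral_horizontalSpeed_affine (a := 3) (by norm_num) (-2)]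
  refine add_le_add ?_ ?_
  · rw [setLIntegral_congr_fun measurableSet_Iio fun t ht =>
      horizontalSpeed_congr (concat_eventuallyEq_left γ₁ γ₂ ht)]
    exact setLIntegral_le_lintegral _ _
  · rw [setLIntegral_congr_fun measurableSet_Iio.compl fun t ht =>
      horizontalSpeed_congr (h₁.concat_eventuallyEq_right h₂ (t := t) ?_)]
    · exact setLIntegral_le_lintegral _ _
    · have : 1 / 2 ≤ t := not_lt.1 ht
      linarith

/-- `f` and `g` are joined by deformations of arbitrarily small horizontal length. -/
def Indistinguishable (f g : Imm m n M N) : Prop :=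
  ∀ ε : ENNReal, 0 < ε → ∃ γ, IsDeformation γ f g ∧ horizontalLength γ < ε

theorem Indistinguishable.refl (f : Imm m n M N) : Indistinguishable f f := by
  intro ε hε
  refine ⟨_, isDeformation_const f, ?_⟩
  rw [(isDeformation_const f).horizontalLength_eq]
  simpa [horizontalSpeed_const] using hε

theorem Indistinguishable.symm {f g : Imm m n M N} (h : Indistinguishable f g) :
    Indistinguishable g f := by
  intro ε hε
  obtain ⟨γ, hγ, hl⟩ := h ε hε
  exact ⟨_, hγ.reverse, hγ.horizontalLength_reverse.trans_lt hl⟩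

theorem Indistinguishable.trans {f g h : Imm m n M N} (h₁ : Indistinguishable f g)
    (h₂ : Indistinguishable g h) : Indistinguishable f h := by
  intro ε hε
  obtain ⟨γ₁, hγ₁, hl₁⟩ := h₁ (ε / 2) (ENNReal.half_pos hε.ne')
  obtain ⟨γ₂, hγ₂, hl₂⟩ := h₂ (ε / 2) (ENNReal.half_pos hε.ne')
  refine ⟨_, hγ₁.concat hγ₂, (hγ₁.horizontalLength_concat_le hγ₂).trans_lt ?_⟩
  rw [← ENNReal.add_halves ε]
  exact ENNReal.add_lt_add hl₁ hl₂

end HorizontalLength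

/-! ### Adding a vector field to a map inside a chart. -/

section ChartAddition

variable {n : ℕ} {N : Type*} [TopologicalSpace N] [ChartedSpace (EuclideanSpace ℝ (Fin n)) N]
  {X : Type*}

open Classical in
/-- The map `F + v`, where the sum is taken in the preferred chart at `y₀`, at the points where
`v ≠ 0`. -/
noncomputable def chartAdd (y₀ : N) (F : X → N) (v : X → EuclideanSpace ℝ (Fin n)) (x : X) : N :=
  if v x = 0 then F x else (chartAt (EuclideanSpace ℝ (Fin n)) y₀).symm
    (chartAt (EuclideanSpace ℝ (Fin n)) y₀ (F x) + v x)

variable {y₀ : N} {F : X → N} {v : X → EuclideanSpace ℝ (Fin n)} {x : X}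

theorem chartAdd_of_eq_zero (h : v x = 0) : chartAdd y₀ F v x = F x := if_pos h

theorem chartAdd_of_mem (h : F x ∈ (chartAt (EuclideanSpace ℝ (Fin n)) y₀).source) :
    chartAdd y₀ F v x = (chartAt (EuclideanSpace ℝ (Fin n)) y₀).symm
      (chartAt (EuclideanSpace ℝ (Fin n)) y₀ (F x) + v x) := by
  unfold chartAdd
  split_ifs with h0
  · rw [h0, add_zero, OpenPartialHomeomorph.left_inv _ h]
  · rfl

/-- The addition of `v` to `F` in the preferred chart at `y₀` is possible at `x`. -/
def ChartAddable (y₀ : N) (F : X → N) (v : X → EuclideanSpace ℝ (Fin n)) (x : X) : Prop :=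
  F x ∈ (chartAt (EuclideanSpace ℝ (Fin n)) y₀).source ∧
    chartAt (EuclideanSpace ℝ (Fin n)) y₀ (F x) + v x ∈
      (chartAt (EuclideanSpace ℝ (Fin n)) y₀).target

theorem ChartAddable.mem_source (h : ChartAddable y₀ F v x) :
    chartAdd y₀ F v x ∈ (chartAt (EuclideanSpace ℝ (Fin n)) y₀).source := by
  rw [chartAdd_of_mem h.1]
  exact OpenPartialHomeomorph.map_target _ h.2

theorem ChartAddable.chart_chartAdd (h : ChartAddable y₀ F v x) :
    chartAt (EuclideanSpace ℝ (Fin n)) y₀ (chartAdd y₀ F v x) =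
      chartAt (EuclideanSpace ℝ (Fin n)) y₀ (F x) + v x := by
  rw [chartAdd_of_mem h.1]
  exact OpenPartialHomeomorph.right_inv _ h.2

theorem chartAdd_chartAdd {w : X → EuclideanSpace ℝ (Fin n)}
    (h : ChartAddable y₀ F v x ∨ v x = 0 ∧ w x = 0) :
    chartAdd y₀ (chartAdd y₀ F v) w x = chartAdd y₀ F (fun x => v x + w x) x := by
  rcases h with h | ⟨h1, h2⟩
  · rw [chartAdd_of_mem h.mem_source, h.chart_chartAdd, chartAdd_of_mem h.1, add_assoc]
  · rw [chartAdd_of_eq_zero h2, chartAdd_of_eq_zero h1, chartAdd_of_eq_zero]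
    simp [h1, h2]

theorem eventually_chartAddable [TopologicalSpace X] (hF : ContinuousAt F x)
    (hv : ContinuousAt v x) (h : ChartAddable y₀ F v x) :
    ∀ᶠ x' in nhds x, ChartAddable y₀ F v x' := by
  have h1 : ContinuousAt (fun x' => chartAt (EuclideanSpace ℝ (Fin n)) y₀ (F x') + v x') x :=
    (((chartAt (EuclideanSpace ℝ (Fin n)) y₀).continuousAt h.1).comp hF).add hv
  exact (hF.eventually_mem ((chartAt (EuclideanSpace ℝ (Fin n)) y₀).open_source.mem_nhds h.1)).and
    (h1.eventually_mem ((chartAt (EuclideanSpace ℝ (Fin n)) y₀).open_target.mem_nhds h.2))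

theorem chartAdd_eventuallyEq [TopologicalSpace X] (h : v =ᶠ[nhds x] 0) :
    chartAdd y₀ F v =ᶠ[nhds x] F := by
  filter_upwards [h] with x' hx' using chartAdd_of_eq_zero hx'

theorem ChartAddable.contMDiffAt [IsManifold (𝓡 n) ∞ N] [TopologicalSpace X] {EX HX : Type*}
    [NormedAddCommGroup EX] [NormedSpace ℝ EX] [TopologicalSpace HX] {I : ModelWithCorners ℝ EX HX}
    [ChartedSpace HX X]
    (hF : ContMDiffAt I (𝓡 n) ∞ F x) (hv : ContMDiffAt I (𝓡 n) ∞ v x)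
    (h : ChartAddable y₀ F v x) : ContMDiffAt I (𝓡 n) ∞ (chartAdd y₀ F v) x := by
  set ψ := chartAt (EuclideanSpace ℝ (Fin n)) y₀ with hψ
  have h1 : ContMDiffAt (𝓡 n) (𝓡 n) ∞ ψ (F x) :=
    contMDiffAt_of_mem_maximalAtlas (IsManifold.chart_mem_maximalAtlas y₀) h.1
  have h2 : ContMDiffAt (𝓡 n) (𝓡 n) ∞ ψ.symm (ψ (F x) + v x) :=
    contMDiffAt_symm_of_mem_maximalAtlas (IsManifold.chart_mem_maximalAtlas y₀) h.2
  have h3 : ContMDiffAt I (𝓡 n) ∞ (fun x' => ψ (F x') + v x') x := (h1.comp x hF).add hv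
  refine (h2.comp x h3).congr_of_eventuallyEq ?_
  filter_upwards [hF.continuousAt.eventually_mem (ψ.open_source.mem_nhds h.1)] with x' hx'
  exact chartAdd_of_mem hx'

end ChartAddition

/-! ### Directions transverse to an immersion. -/

section Transversality

variable {m n : ℕ} {M N : Type*}
  [TopologicalSpace M] [ChartedSpace (EuclideanSpace ℝ (Fin m)) M] [IsManifold (𝓡 m) ∞ M]
  [TopologicalSpace N] [ChartedSpace (EuclideanSpace ℝ (Fin n)) N] [IsManifold (𝓡 n) ∞ N]

variable (m) in
/-- The differential at `x` of `F`, read in the preferred chart at `y₀`. -/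
noncomputable def chartDeriv (y₀ : N) (F : M → N) (x : M) :
    EuclideanSpace ℝ (Fin m) →L[ℝ] EuclideanSpace ℝ (Fin n) :=
  mfderiv (𝓡 m) (𝓡 n) (chartAt (EuclideanSpace ℝ (Fin n)) y₀ ∘ F) x

variable (m) in
/-- The map `F`, read in the preferred chart at `y₀`, is immersive at `x` and transverse to the
direction `e`. -/
def IsTransverseAt (y₀ : N) (F : M → N) (e : EuclideanSpace ℝ (Fin n)) (x : M) : Prop :=
  ∀ (v : EuclideanSpace ℝ (Fin m)) (c : ℝ), chartDeriv m y₀ F x v + c • e = 0 → v = 0 ∧ c = 0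

variable {y₀ : N} {F : M → N} {e : EuclideanSpace ℝ (Fin n)} {x : M} {w : M → ℝ}

omit [IsManifold (𝓡 m) ∞ M] in
theorem mdifferentiableAt_chart_comp (hF : MDifferentiableAt (𝓡 m) (𝓡 n) F x)
    (h : F x ∈ (chartAt (EuclideanSpace ℝ (Fin n)) y₀).source) :
    MDifferentiableAt (𝓡 m) (𝓡 n) (chartAt (EuclideanSpace ℝ (Fin n)) y₀ ∘ F) x :=
  ((mdifferentiable_chart y₀).mdifferentiableAt h).comp x hF

omit [IsManifold (𝓡 m) ∞ M] in
theorem injective_mfderiv_of_chart (hF : MDifferentiableAt (𝓡 m) (𝓡 n) F x)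
    (h : F x ∈ (chartAt (EuclideanSpace ℝ (Fin n)) y₀).source)
    (hinj : Function.Injective
      (chartDeriv m (n := n) y₀ F x)) :
    Function.Injective (mfderiv (𝓡 m) (𝓡 n) F x) := by
  unfold chartDeriv at hinj
  rw [mfderiv_comp x ((mdifferentiable_chart y₀).mdifferentiableAt h) hF] at hinj
  exact Function.Injective.of_comp hinj

omit [IsManifold (𝓡 m) ∞ M] in
theorem IsTransverseAt.injective_mfderiv (ht : IsTransverseAt m y₀ F e x)
    (hF : MDifferentiableAt (𝓡 m) (𝓡 n) F x)
    (h : F x ∈ (chartAt (EuclideanSpace ℝ (Fin n)) y₀).source) :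
    Function.Injective (mfderiv (𝓡 m) (𝓡 n) F x) := by
  refine injective_mfderiv_of_chart hF h ?_
  rw [injective_iff_map_eq_zero]
  intro v hv
  refine (ht v 0 ?_).1
  rw [zero_smul, add_zero]
  exact hv

-- The differential changes by `dw` times `e`, which is absorbed into the coefficient `c` of `e`. No
-- bound on `dw` is needed, so arbitrarily fast oscillations are allowed.
omit [IsManifold (𝓡 m) ∞ M] in
theorem ChartAddable.isTransverseAt (hF : ContMDiffAt (𝓡 m) (𝓡 n) ∞ F x)
    (hw : ContMDiffAt (𝓡 m) 𝓘(ℝ, ℝ) ∞ w x)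
    (h : ChartAddable y₀ F (fun x => w x • e) x) (ht : IsTransverseAt m y₀ F e x) :
    IsTransverseAt m y₀ (chartAdd y₀ F fun x => w x • e) e x := by
  set ψ := chartAt (EuclideanSpace ℝ (Fin n)) y₀ with hψ
  have hwe : ContMDiffAt (𝓡 m) (𝓡 n) ∞ (fun x => w x • e) x := hw.smul contMDiffAt_const
  have heq : (ψ ∘ chartAdd y₀ F fun x => w x • e) =ᶠ[nhds x]
      (ψ ∘ F) + fun x => w x • e := by
    filter_upwards [eventually_chartAddable hF.continuousAt hwe.continuousAt h] with x' hx'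
    exact hx'.chart_chartAdd
  have hF1 : MDifferentiableAt (𝓡 m) (𝓡 n) (ψ ∘ F) x :=
    mdifferentiableAt_chart_comp (hF.mdifferentiableAt (by simp)) h.1
  have hw1 : MDifferentiableAt (𝓡 m) 𝓘(ℝ, ℝ) w x := hw.mdifferentiableAt (by simp)
  have hsmul : HasMFDerivAt (𝓡 m) (𝓡 n) (fun x => w x • e) x
      ((ContinuousLinearMap.toSpanSingleton ℝ e : ℝ →L[ℝ] EuclideanSpace ℝ (Fin n)).comp
        (mfderiv (𝓡 m) 𝓘(ℝ, ℝ) w x : TangentSpace (𝓡 m) x →L[ℝ] ℝ)) := by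
    have h1 : HasMFDerivAt 𝓘(ℝ, ℝ) (𝓡 n) (fun c : ℝ => c • e) (w x)
        (ContinuousLinearMap.toSpanSingleton ℝ e) :=
      (ContinuousLinearMap.toSpanSingleton ℝ e : ℝ →L[ℝ] EuclideanSpace ℝ (Fin n)).hasMFDerivAt
    exact h1.comp x hw1.hasMFDerivAt
  have hder := (hF1.hasMFDerivAt.add hsmul).congr_of_eventuallyEq heq
  let dw : EuclideanSpace ℝ (Fin m) →L[ℝ] ℝ := mfderiv (𝓡 m) 𝓘(ℝ, ℝ) w x
  intro v c hvc
  unfold chartDeriv at hvc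
  rw [hder.mfderiv] at hvc
  have hvc' : chartDeriv m y₀ F x v + dw v • e + c • e = 0 := hvc
  obtain ⟨h2, h3⟩ := ht v (dw v + c) (by rw [add_smul, ← add_assoc]; exact hvc')
  subst h2
  rw [map_zero, zero_add] at h3
  exact ⟨rfl, h3⟩

end Transversality

theorem range_eq_span_comp {ι V V' V'' : Type*} [AddCommGroup V] [Module ℝ V] [AddCommGroup V']
    [Module ℝ V'] [AddCommGroup V''] [Module ℝ V''] (L : V' →ₗ[ℝ] V'') (T : V →ₗ[ℝ] V')
    (hT : Function.Surjective T) {b : ι → V} (hb : Submodule.span ℝ (Set.range b) = ⊤) :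
    LinearMap.range L = Submodule.span ℝ (Set.range fun i => L (T (b i))) := by
  have h : (Set.range fun i => L (T (b i))) = (L ∘ₗ T) '' Set.range b := by
    rw [← Set.range_comp]; rfl
  rw [h, Submodule.span_image, hb, Submodule.map_top,
    LinearMap.range_comp_of_range_eq_top _ (LinearMap.range_eq_top.2 hT)]

/-! ### Straight paths in a transverse direction and their energy density. -/

section TransverseBumps

variable {m n : ℕ} {M N : Type*}
  [TopologicalSpace M] [ChartedSpace (EuclideanSpace ℝ (Fin m)) M]
  [TopologicalSpace N] [ChartedSpace (EuclideanSpace ℝ (Fin n)) N]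

/-- The function `h` is supported in a compact subset `K` of the chart domain at `x₀`, the
direction `e` is transverse to `F` on `K`, and the addition of `h • e` to `F` in the chart at `y₀`
stays in a convex subset `W` of the chart. -/
structure TransverseBump (F : Imm m n M N) (x₀ : M) (y₀ : N) (e : EuclideanSpace ℝ (Fin n))
    (K : Set M) (W : Set (EuclideanSpace ℝ (Fin n))) (h : M → ℝ) : Prop where
  isCompact : IsCompact K
  subset_source : K ⊆ (chartAt (EuclideanSpace ℝ (Fin m)) x₀).source
  smooth : ContMDiff (𝓡 m) 𝓘(ℝ, ℝ) ∞ h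
  eq_zero : ∀ x ∉ K, h x = 0
  convex : Convex ℝ W
  subset_target : W ⊆ (chartAt (EuclideanSpace ℝ (Fin n)) y₀).target
  mem_source : ∀ x ∈ K, F x ∈ (chartAt (EuclideanSpace ℝ (Fin n)) y₀).source
  mem : ∀ x ∈ K, chartAt (EuclideanSpace ℝ (Fin n)) y₀ (F x) ∈ W
  add_mem : ∀ x ∈ K, chartAt (EuclideanSpace ℝ (Fin n)) y₀ (F x) + h x • e ∈ W
  transverse : ∀ x ∈ K, IsTransverseAt m y₀ F e x

namespace TransverseBump

variable {F : Imm m n M N} {x₀ : M} {y₀ : N} {e : EuclideanSpace ℝ (Fin n)} {K : Set M}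
  {W : Set (EuclideanSpace ℝ (Fin n))} {h : M → ℝ}

theorem chartAddable (B : TransverseBump F x₀ y₀ e K W h) {x : M} (hx : x ∈ K) :
    ChartAddable y₀ F (fun x => h x • e) x :=
  ⟨B.mem_source x hx, B.subset_target (B.add_mem x hx)⟩

/-- Multiplication of a transverse bump with a factor between `0` and `1`. -/
theorem mul (B : TransverseBump F x₀ y₀ e K W h) {w : M → ℝ}
    (hw : ContMDiff (𝓡 m) 𝓘(ℝ, ℝ) ∞ w) (hρ : ∀ x, ∃ ρ ∈ Set.Icc (0 : ℝ) 1, w x = ρ * h x) :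
    TransverseBump F x₀ y₀ e K W w where
  isCompact := B.isCompact
  subset_source := B.subset_source
  smooth := hw
  eq_zero x hx := by
    obtain ⟨ρ, -, h1⟩ := hρ x
    rw [h1, B.eq_zero x hx, mul_zero]
  convex := B.convex
  subset_target := B.subset_target
  mem_source := B.mem_source
  mem := B.mem
  add_mem x hx := by
    obtain ⟨ρ, h0, h1⟩ := hρ x
    rw [h1, mul_smul]
    exact B.convex.add_smul_mem (B.mem x hx) (B.add_mem x hx) h0
  transverse := B.transverse

theorem scale (B : TransverseBump F x₀ y₀ e K W h) (t : ℝ) :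
    TransverseBump F x₀ y₀ e K W fun x => Real.smoothTransition t * h x :=
  B.mul (contMDiff_const.mul B.smooth)
    fun _ => ⟨_, ⟨Real.smoothTransition.nonneg t, Real.smoothTransition.le_one t⟩, rfl⟩

theorem eventually_eq_zero [T2Space M] (B : TransverseBump F x₀ y₀ e K W h) {x : M} (hx : x ∉ K) :
    (fun x => h x • e) =ᶠ[nhds x] 0 := by
  filter_upwards [B.isCompact.isClosed.isOpen_compl.mem_nhds hx] with x' hx'
  simp [B.eq_zero x' hx']

variable [T2Space M] [IsManifold (𝓡 n) ∞ N]

theorem contMDiff_chartAdd (B : TransverseBump F x₀ y₀ e K W h) :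
    ContMDiff (𝓡 m) (𝓡 n) ∞ (chartAdd y₀ F fun x => h x • e) := by
  intro x
  by_cases hx : x ∈ K
  · exact (B.chartAddable hx).contMDiffAt F.smooth.contMDiffAt
      (B.smooth.contMDiffAt.smul contMDiffAt_const)
  · exact F.smooth.contMDiffAt.congr_of_eventuallyEq
      (chartAdd_eventuallyEq (B.eventually_eq_zero hx))

omit [T2Space M] in
theorem isTransverseAt_chartAdd (B : TransverseBump F x₀ y₀ e K W h) {x : M} (hx : x ∈ K) :
    IsTransverseAt m y₀ (chartAdd y₀ F fun x => h x • e) e x :=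
  (B.chartAddable hx).isTransverseAt F.smooth.contMDiffAt B.smooth.contMDiffAt (B.transverse x hx)

/-- The immersion `F + h • e`. -/
noncomputable def imm (B : TransverseBump F x₀ y₀ e K W h) : Imm m n M N where
  toFun := chartAdd y₀ F fun x => h x • e
  smooth := B.contMDiff_chartAdd
  injective_mfderiv x := by
    by_cases hx : x ∈ K
    · exact (B.isTransverseAt_chartAdd hx).injective_mfderiv
        (B.contMDiff_chartAdd.mdifferentiable (by simp) x) (B.chartAddable hx).mem_source
    · rw [(chartAdd_eventuallyEq (B.eventually_eq_zero hx)).mfderiv_eq]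
      exact F.injective_mfderiv x

/-- The straight path from `F` to `F + h • e`. -/
noncomputable def path (B : TransverseBump F x₀ y₀ e K W h) (t : ℝ) : Imm m n M N := (B.scale t).imm

theorem isDeformation_path (B : TransverseBump F x₀ y₀ e K W h) :
    IsDeformation B.path F B.imm where
  contMDiff := by
    rintro ⟨t, x⟩
    have hF : ContMDiffAt (𝓘(ℝ, ℝ).prod (𝓡 m)) (𝓡 n) ∞ (fun p : ℝ × M => F p.2) (t, x) :=
      F.smooth.contMDiffAt.comp _ contMDiffAt_snd
    have hσ : ContMDiff 𝓘(ℝ, ℝ) 𝓘(ℝ, ℝ) ∞ Real.smoothTransition :=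
      contMDiff_iff_contDiff.2 Real.smoothTransition.contDiff
    have hv : ContMDiffAt (𝓘(ℝ, ℝ).prod (𝓡 m)) (𝓡 n) ∞
        (fun p : ℝ × M => (Real.smoothTransition p.1 * h p.2) • e) (t, x) :=
      ((hσ.contMDiffAt.comp _ contMDiffAt_fst).mul
        (B.smooth.contMDiffAt.comp _ contMDiffAt_snd)).smul contMDiffAt_const
    change ContMDiffAt (𝓘(ℝ, ℝ).prod (𝓡 m)) (𝓡 n) ∞ (chartAdd y₀ (fun p : ℝ × M => F p.2)
      fun p : ℝ × M => (Real.smoothTransition p.1 * h p.2) • e) (t, x)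
    by_cases hx : x ∈ K
    · exact ChartAddable.contMDiffAt hF hv ((B.scale t).chartAddable hx)
    · refine hF.congr_of_eventuallyEq (chartAdd_eventuallyEq ?_)
      filter_upwards [continuousAt_snd.eventually_mem
        (B.isCompact.isClosed.isOpen_compl.mem_nhds hx)] with p hp
      simp [B.eq_zero _ hp]
  eq_left t ht := Imm.ext fun x => by
    change chartAdd y₀ F (fun x => (Real.smoothTransition t * h x) • e) x = F x
    refine chartAdd_of_eq_zero ?_
    simp [Real.smoothTransition.zero_of_nonpos ht]
  eq_right t ht := Imm.ext fun x => by
    change chartAdd y₀ F (fun x => (Real.smoothTransition t * h x) • e) x =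
      chartAdd y₀ F (fun x => h x • e) x
    simp [Real.smoothTransition.one_of_one_le ht]

/-- The bump that leads back from `F + h • e`. -/
theorem neg_mul (B : TransverseBump F x₀ y₀ e K W h) {w : M → ℝ}
    (hw : ContMDiff (𝓡 m) 𝓘(ℝ, ℝ) ∞ w) (hρ : ∀ x, ∃ ρ ∈ Set.Icc (0 : ℝ) 1, w x = ρ * -h x) :
    TransverseBump B.imm x₀ y₀ e K W w where
  isCompact := B.isCompact
  subset_source := B.subset_source
  smooth := hw
  eq_zero x hx := by
    obtain ⟨ρ, -, h1⟩ := hρ x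
    rw [h1, B.eq_zero x hx, neg_zero, mul_zero]
  convex := B.convex
  subset_target := B.subset_target
  mem_source x hx := (B.chartAddable hx).mem_source
  mem x hx := by
    have h1 := (B.chartAddable hx).chart_chartAdd
    change chartAt (EuclideanSpace ℝ (Fin n)) y₀ (chartAdd y₀ F (fun x => h x • e) x) ∈ W
    rw [h1]
    exact B.add_mem x hx
  add_mem x hx := by
    obtain ⟨ρ, h0, h1⟩ := hρ x
    have h2 := (B.chartAddable hx).chart_chartAdd
    change chartAt (EuclideanSpace ℝ (Fin n)) y₀ (chartAdd y₀ F (fun x => h x • e) x) + _ ∈ W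
    rw [h2]
    -- Moving back by `ρ h` from `F + h • e` gives `F + (1 - ρ) h • e`, a point of the segment
    -- inside `W`.
    have h3 := B.convex.add_smul_mem (B.mem x hx) (B.add_mem x hx) (t := 1 - ρ)
      ⟨by linarith [h0.2], by linarith [h0.1]⟩
    convert h3 using 1
    rw [h1]
    module
  transverse x hx := B.isTransverseAt_chartAdd hx

/-- This makes the leg leaving `F` and the leg leaving `F + h • e` meet in one and the same
immersion. -/
theorem imm_neg_mul (B : TransverseBump F x₀ y₀ e K W h) {w₁ w₂ : M → ℝ}
    (B₁ : TransverseBump F x₀ y₀ e K W w₁) (B₂ : TransverseBump B.imm x₀ y₀ e K W w₂)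
    (hw : ∀ x, h x + w₂ x = w₁ x) : B₂.imm = B₁.imm := by
  refine Imm.ext fun x => ?_
  change chartAdd y₀ (chartAdd y₀ F (fun x => h x • e)) (fun x => w₂ x • e) x =
    chartAdd y₀ F (fun x => w₁ x • e) x
  rw [chartAdd_chartAdd]
  · congr 1
    funext x
    rw [← hw, add_smul]
  · by_cases hx : x ∈ K
    · exact Or.inl (B.chartAddable hx)
    · simp [B.eq_zero x hx, B₂.eq_zero x hx]

/-! ### The horizontal speed of the straight path -/

omit [T2Space M] [IsManifold (𝓡 n) ∞ N] in
theorem chartAddable_path (B : TransverseBump F x₀ y₀ e K W h) {x : M} (hx : x ∈ K) (t : ℝ) :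
    ChartAddable y₀ F (fun x => (Real.smoothTransition t * h x) • e) x :=
  (B.scale t).chartAddable hx

theorem mfderiv_path_time (B : TransverseBump F x₀ y₀ e K W h) {x : M} (hx : x ∈ K) (t : ℝ) :
    mfderiv 𝓘(ℝ, ℝ) (𝓡 n) (fun s => B.path s x) t (1 : ℝ) =
      (deriv Real.smoothTransition t * h x) • chartSymmL y₀ (B.path t x) e := by
  rw [mfderiv_eq_chartSymmL (B.isDeformation_path.mdifferentiableAt x t)
    ((B.chartAddable_path hx t).mem_source), ← map_smul]
  congr 1
  have h1 : (chartAt (EuclideanSpace ℝ (Fin n)) y₀ ∘ fun s => B.path s x) =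
      fun s => chartAt (EuclideanSpace ℝ (Fin n)) y₀ (F x) +
        (Real.smoothTransition s * h x) • e := by
    funext s
    exact (B.chartAddable_path hx s).chart_chartAdd
  rw [h1]
  have h2 : HasDerivAt Real.smoothTransition (deriv Real.smoothTransition t) t :=
    ((Real.smoothTransition.contDiff (n := 1)).differentiable (by simp) t).hasDerivAt
  have h3 := ((h2.mul_const (h x)).smul_const e).const_add
    (chartAt (EuclideanSpace ℝ (Fin n)) y₀ (F x))
  rw [h3.hasFDerivAt.fderiv]
  simp

variable [IsManifold (𝓡 m) ∞ M]

/-- Together with `mfderiv_path_time` this expresses tangent vectors and velocity through the same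
image of `e` at the moving base point, which is the form required by the Gram determinant estimates.
-/
theorem mfderiv_path_space (B : TransverseBump F x₀ y₀ e K W h) (t : ℝ)
    {u : EuclideanSpace ℝ (Fin m)} (hu : u ∈ (chartAt (EuclideanSpace ℝ (Fin m)) x₀).target)
    (hx : (chartAt (EuclideanSpace ℝ (Fin m)) x₀).symm u ∈ K) (v : EuclideanSpace ℝ (Fin m)) :
    mfderiv (𝓡 m) (𝓡 n) (B.path t ∘ (chartAt (EuclideanSpace ℝ (Fin m)) x₀).symm) u v =
      chartSymmL y₀ (B.path t ((chartAt (EuclideanSpace ℝ (Fin m)) x₀).symm u))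
        (fderiv ℝ (chartAt (EuclideanSpace ℝ (Fin n)) y₀ ∘ F ∘
          (chartAt (EuclideanSpace ℝ (Fin m)) x₀).symm) u v +
        (Real.smoothTransition t *
          fderiv ℝ (h ∘ (chartAt (EuclideanSpace ℝ (Fin m)) x₀).symm) u v) • e) := by
  set φ := chartAt (EuclideanSpace ℝ (Fin m)) x₀ with hφ
  set ψ := chartAt (EuclideanSpace ℝ (Fin n)) y₀ with hψ
  have hsymm : MDifferentiableAt (𝓡 m) (𝓡 m) φ.symm u :=
    (mdifferentiable_chart x₀).mdifferentiableAt_symm hu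
  have hd : MDifferentiableAt (𝓡 m) (𝓡 n) (B.path t ∘ φ.symm) u :=
    ((B.path t).smooth.mdifferentiable (by simp) _).comp u hsymm
  refine (mfderiv_eq_chartSymmL hd ((B.chartAddable_path hx t).mem_source) v).trans ?_
  have hFd : DifferentiableAt ℝ (ψ ∘ F ∘ φ.symm) u := by
    rw [← mdifferentiableAt_iff_differentiableAt]
    exact ((mdifferentiable_chart y₀).mdifferentiableAt (B.mem_source _ hx)).comp u
      ((F.smooth.mdifferentiable (by simp) _).comp u hsymm)
  have hhd : DifferentiableAt ℝ (h ∘ φ.symm) u := by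
    rw [← mdifferentiableAt_iff_differentiableAt]
    exact (B.smooth.mdifferentiable (by simp) _).comp u hsymm
  have heq : (ψ ∘ (B.path t ∘ φ.symm)) =ᶠ[nhds u] fun u' => (ψ ∘ F ∘ φ.symm) u' +
      (Real.smoothTransition t * (h ∘ φ.symm) u') • e := by
    have h1 := eventually_chartAddable F.smooth.continuous.continuousAt
      ((B.scale t).smooth.continuous.smul continuous_const).continuousAt (B.chartAddable_path hx t)
    filter_upwards [(φ.continuousAt_symm hu).eventually h1] with u' hu'
    exact hu'.chart_chartAdd
  have hder := hFd.hasFDerivAt.add ((hhd.hasFDerivAt.const_mul (Real.smoothTransition t)).smul_const e)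
  have h2 : fderiv ℝ (ψ ∘ (B.path t ∘ φ.symm)) u = _ := (hder.congr_of_eventuallyEq heq).fderiv
  rw [h2]
  rfl

omit [T2Space M] [IsManifold (𝓡 n) ∞ N] in
theorem range_mfderiv_eq_span (f : Imm m n M N)
    {u : EuclideanSpace ℝ (Fin m)} (hu : u ∈ (chartAt (EuclideanSpace ℝ (Fin m)) x₀).target) :
    LinearMap.range (mfderiv (𝓡 m) (𝓡 n) f
      ((chartAt (EuclideanSpace ℝ (Fin m)) x₀).symm u)).toLinearMap =
    Submodule.span ℝ (Set.range fun i : Fin m =>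
      (mfderiv (𝓡 m) (𝓡 n) (f ∘ (chartAt (EuclideanSpace ℝ (Fin m)) x₀).symm) u
        (EuclideanSpace.single i (1 : ℝ)) :
          TangentSpace (𝓡 n) (f ((chartAt (EuclideanSpace ℝ (Fin m)) x₀).symm u)))) := by
  set φ := chartAt (EuclideanSpace ℝ (Fin m)) x₀ with hφ
  have hsymm : MDifferentiableAt (𝓡 m) (𝓡 m) φ.symm u :=
    (mdifferentiable_chart x₀).mdifferentiableAt_symm hu
  have hsurj : Function.Surjective (mfderiv (𝓡 m) (𝓡 m) φ.symm u) :=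
    (mdifferentiable_chart x₀).symm.mfderiv_surjective hu
  have hspan : Submodule.span ℝ (Set.range fun i : Fin m =>
      (EuclideanSpace.single i (1 : ℝ) : EuclideanSpace ℝ (Fin m))) = ⊤ := by
    have h1 := (EuclideanSpace.basisFun (Fin m) ℝ).toBasis.span_eq
    have h2 : (fun i : Fin m => (EuclideanSpace.single i (1 : ℝ) : EuclideanSpace ℝ (Fin m))) =
        (EuclideanSpace.basisFun (Fin m) ℝ).toBasis := by
      funext i; simp
    rwa [h2]
  refine (range_eq_span_comp (mfderiv (𝓡 m) (𝓡 n) f (φ.symm u)).toLinearMap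
    (mfderiv (𝓡 m) (𝓡 m) φ.symm u).toLinearMap hsurj hspan).trans ?_
  congr 2
  funext i
  exact (mfderiv_comp_apply u (f.smooth.mdifferentiable (by simp) _) hsymm _).symm

variable [Bundle.RiemannianBundle (fun y : N => TangentSpace (𝓡 n) y)]

/-- The density of the horizontal energy of the straight path, in the chart at `x₀`. -/
theorem density_le (B : TransverseBump F x₀ y₀ e K W h) {C R : ℝ} (hC : 0 ≤ C)
    (hCW : ∀ y ∈ (chartAt (EuclideanSpace ℝ (Fin n)) y₀).source,
      chartAt (EuclideanSpace ℝ (Fin n)) y₀ y ∈ W → ∀ v, ‖chartSymmL (n := n) y₀ y v‖ ≤ C * ‖v‖)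
    (he : ‖e‖ ≤ R) (t : ℝ)
    {u : EuclideanSpace ℝ (Fin m)} (hu : u ∈ (chartAt (EuclideanSpace ℝ (Fin m)) x₀).target)
    (hx : (chartAt (EuclideanSpace ℝ (Fin m)) x₀).symm u ∈ K)
    (hR : ∀ i, ‖fderiv ℝ (chartAt (EuclideanSpace ℝ (Fin n)) y₀ ∘ F ∘
          (chartAt (EuclideanSpace ℝ (Fin m)) x₀).symm) u (EuclideanSpace.single i (1 : ℝ))‖ ≤ R) :
    ∃ p : ℝ, 0 ≤ p ∧ p ≤ C * R ∧
      (∀ i, |Real.smoothTransition t *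
          fderiv ℝ (h ∘ (chartAt (EuclideanSpace ℝ (Fin m)) x₀).symm) u
            (EuclideanSpace.single i (1 : ℝ))| * p ≤ C * R) ∧
      ENNReal.ofReal (√(pullbackMatrix (m := m) (n := n) (B.path t) x₀ u).det) *
        ‖normalPart (B.path t) ((chartAt (EuclideanSpace ℝ (Fin m)) x₀).symm u)
          (mfderiv 𝓘(ℝ, ℝ) (𝓡 n)
            (fun s => B.path s ((chartAt (EuclideanSpace ℝ (Fin m)) x₀).symm u)) t (1 : ℝ))‖ₑ ^ 2 ≤
      ENNReal.ofReal (√((m + 1).factorial * ((C * R) ^ 2) ^ (m + 1)) *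
        (deriv Real.smoothTransition t *
          h ((chartAt (EuclideanSpace ℝ (Fin m)) x₀).symm u)) ^ 2 * p) := by
  set φ := chartAt (EuclideanSpace ℝ (Fin m)) x₀ with hφ
  set ψ := chartAt (EuclideanSpace ℝ (Fin n)) y₀ with hψ
  set x := φ.symm u with hxu
  set f := B.path t with hf
  set A := fderiv ℝ (ψ ∘ F ∘ φ.symm) u with hA
  have hfx : ChartAddable y₀ F (fun x => (Real.smoothTransition t * h x) • e) x :=
    B.chartAddable_path hx t
  have hP : ∀ v, ‖chartSymmL (n := n) y₀ (f x) v‖ ≤ C * ‖v‖ := by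
    refine hCW (f x) hfx.mem_source ?_
    have h1 : ψ (f x) = ψ (F x) + (Real.smoothTransition t * h x) • e := hfx.chart_chartAdd
    rw [h1]
    exact (B.scale t).add_mem x hx
  set a : Fin m → TangentSpace (𝓡 n) (f x) := fun i =>
    chartSymmL y₀ (f x) (A (EuclideanSpace.single i (1 : ℝ))) with ha
  set c : Fin m → ℝ := fun i => Real.smoothTransition t *
    fderiv ℝ (h ∘ φ.symm) u (EuclideanSpace.single i (1 : ℝ)) with hc
  set E : TangentSpace (𝓡 n) (f x) := chartSymmL y₀ (f x) e with hE
  have hcol : ∀ i : Fin m, (mfderiv (𝓡 m) (𝓡 n) (f ∘ φ.symm) u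
      (EuclideanSpace.single i (1 : ℝ)) : TangentSpace (𝓡 n) (f x)) = a i + c i • E := by
    intro i
    refine (B.mfderiv_path_space t hu hx _).trans ?_
    rw [map_add, map_smul]
  have ha_le : ∀ i, ‖a i‖ ≤ C * R := fun i =>
    (hP _).trans (mul_le_mul_of_nonneg_left (hR i) hC)
  have hE_le : ‖E‖ ≤ C * R := (hP _).trans (mul_le_mul_of_nonneg_left he hC)
  set S := LinearMap.range (mfderiv (𝓡 m) (𝓡 n) f x).toLinearMap with hS
  have hSspan : S = Submodule.span ℝ (Set.range fun i => a i + c i • E) := by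
    rw [hS, ← funext hcol]
    exact range_mfderiv_eq_span f hu
  have hgram : pullbackMatrix (m := m) (n := n) f x₀ u =
      Matrix.gram ℝ fun i => a i + c i • E := by
    rw [← funext hcol]; rfl
  -- The witness `p` is the length of the normal part of `e`, transported to the moving base point.
  refine ⟨‖Sᗮ.starProjection E‖, norm_nonneg _,
    (Submodule.norm_starProjection_apply_le _ _).trans hE_le,
    fun i => (abs_mul_norm_starProjection_le hSspan i).trans (ha_le i), ?_⟩
  have hvel : normalPart f x (mfderiv 𝓘(ℝ, ℝ) (𝓡 n) (fun s => B.path s x) t (1 : ℝ)) =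
      (deriv Real.smoothTransition t * h x) • Sᗮ.starProjection E := by
    rw [B.mfderiv_path_time hx t]
    exact map_smul _ _ _
  rw [hvel, hgram, ← ofReal_norm, ← ENNReal.ofReal_pow (norm_nonneg _),
    ← ENNReal.ofReal_mul (Real.sqrt_nonneg _)]
  apply ENNReal.ofReal_le_ofReal
  have hκ := sqrt_det_gram_mul_norm_starProjection_le hSspan ha_le hE_le
  rw [Fintype.card_fin] at hκ
  rw [norm_smul, Real.norm_eq_abs, mul_pow, sq_abs]
  -- Of the two factors in `‖E^⊥‖²`, one absorbs the volume density, uniformly in the slopes; the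
  -- other is kept as `p` and supplies the smallness.
  calc _ = (√(Matrix.gram ℝ fun i => a i + c i • E).det * ‖Sᗮ.starProjection E‖) *
        ((deriv Real.smoothTransition t * h x) ^ 2 * ‖Sᗮ.starProjection E‖) := by ring
    _ ≤ √((m + 1).factorial * ((C * R) ^ 2) ^ (m + 1)) *
        ((deriv Real.smoothTransition t * h x) ^ 2 * ‖Sᗮ.starProjection E‖) :=
      mul_le_mul_of_nonneg_right hκ (by positivity)
    _ = _ := by ring

end TransverseBump

end TransverseBumps

/-! ### Oscillating bumps have short paths. -/

section Oscillation

/-- Along an oscillating bump, the energy density is small where the oscillation has a large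
derivative. -/
theorem energy_density_le_of_oscillation {κ S Q H η s₀ σ σ' h w dw p c : ℝ} {k : ℝ} (hκ : 0 ≤ κ)
    (hη : 0 < η) (hs₀ : 0 < s₀) (hp : 0 ≤ p) (hpQ : p ≤ Q) (hσ' : |σ'| ≤ S)
    (hs : s₀ ≤ σ) (hh : |h| ≤ H) (hw : |w| ≤ |h|) (hpd : |σ * dw| * p ≤ Q)
    (hc : η ≤ |c|) (hdw : k * (|h| * |c|) / 2 - H ≤ |dw|) (hk : 4 * H ≤ k * η ^ 2)
    (hk' : 4 * H ^ 2 ≤ k * (s₀ * η ^ 4)) (hk0 : 0 ≤ k) :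
    κ * (σ' * w) ^ 2 * p ≤ κ * S ^ 2 * Q * η ^ 2 := by
  have hS : σ' ^ 2 ≤ S ^ 2 := sq_le_sq' (by linarith [(abs_le.1 hσ').1]) (abs_le.1 hσ').2
  have key : w ^ 2 * p ≤ η ^ 2 * Q := by
    have hw2 : w ^ 2 ≤ |h| ^ 2 := by
      rw [← sq_abs w]
      exact pow_le_pow_left₀ (abs_nonneg _) hw 2
    -- If `|h| < η`, then `w` itself is small and `p ≤ Q` suffices. Otherwise the slope `|dw|` is at
    -- least `kη²/4`, so `p` is at most a multiple of `1/k`, and `hk'` makes `w² p` as small as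
    -- required.
    rcases lt_or_ge |h| η with h1 | h1
    · have : w ^ 2 ≤ η ^ 2 := hw2.trans (pow_le_pow_left₀ (abs_nonneg _) h1.le 2)
      exact mul_le_mul this hpQ hp (by positivity)
    · have h2 : η ^ 2 ≤ |h| * |c| := by
        rw [sq]; exact mul_le_mul h1 hc hη.le (abs_nonneg _)
      have h3 : k * η ^ 2 / 4 ≤ |dw| := by
        have : k * η ^ 2 ≤ k * (|h| * |c|) := mul_le_mul_of_nonneg_left h2 hk0
        linarith
      have h4 : s₀ * (k * η ^ 2 / 4) * p ≤ Q := by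
        refine le_trans (mul_le_mul_of_nonneg_right ?_ hp) hpd
        rw [abs_mul, abs_of_pos (hs₀.trans_le hs)]
        exact mul_le_mul hs h3 (by positivity) (hs₀.le.trans hs)
      have hw3 : w ^ 2 ≤ H ^ 2 := hw2.trans (pow_le_pow_left₀ (abs_nonneg _) hh 2)
      have h5 : η ^ 2 * (s₀ * (k * η ^ 2 / 4) * p) ≤ η ^ 2 * Q :=
        mul_le_mul_of_nonneg_left h4 (by positivity)
      have h6 : w ^ 2 * p ≤ H ^ 2 * p := mul_le_mul_of_nonneg_right hw3 hp
      have h7 : 4 * H ^ 2 * p ≤ k * (s₀ * η ^ 4) * p := mul_le_mul_of_nonneg_right hk' hp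
      nlinarith
  have h8 : σ' ^ 2 * (w ^ 2 * p) ≤ S ^ 2 * (η ^ 2 * Q) :=
    mul_le_mul hS key (by positivity) (by positivity)
  calc κ * (σ' * w) ^ 2 * p = κ * (σ' ^ 2 * (w ^ 2 * p)) := by ring
    _ ≤ κ * (S ^ 2 * (η ^ 2 * Q)) := mul_le_mul_of_nonneg_left h8 hκ
    _ = _ := by ring

variable {m n : ℕ} {M N : Type*}
  [TopologicalSpace M] [ChartedSpace (EuclideanSpace ℝ (Fin m)) M] [T2Space M]
  [IsManifold (𝓡 m) ∞ M] [MeasurableSpace M] [BorelSpace M]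
  [TopologicalSpace N] [ChartedSpace (EuclideanSpace ℝ (Fin n)) N] [IsManifold (𝓡 n) ∞ N]
  [Bundle.RiemannianBundle (fun y : N => TangentSpace (𝓡 n) y)]

namespace TransverseBump

variable {F : Imm m n M N} {x₀ : M} {y₀ : N} {e : EuclideanSpace ℝ (Fin n)} {K : Set M}
  {W : Set (EuclideanSpace ℝ (Fin n))} {h : M → ℝ}

omit [T2Space M] [IsManifold (𝓡 m) ∞ M] [MeasurableSpace M] [BorelSpace M]
  [IsManifold (𝓡 n) ∞ N] [Bundle.RiemannianBundle (fun y : N => TangentSpace (𝓡 n) y)] in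
theorem isCompact_image (B : TransverseBump F x₀ y₀ e K W h) :
    IsCompact (chartAt (EuclideanSpace ℝ (Fin m)) x₀ '' K) :=
  B.isCompact.image_of_continuousOn
    ((chartAt (EuclideanSpace ℝ (Fin m)) x₀).continuousOn.mono B.subset_source)

/-- The velocity vanishes off `K`, so one chart carries the whole energy. Passing to a majorant `β`
again avoids measurability of the density. -/
theorem horizontalSpeed_path_le (B : TransverseBump F x₀ y₀ e K W h) (t : ℝ)
    {β : EuclideanSpace ℝ (Fin m) → ENNReal}
    (hβ : ∀ u ∈ chartAt (EuclideanSpace ℝ (Fin m)) x₀ '' K,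
      ENNReal.ofReal (√(pullbackMatrix (m := m) (n := n) (B.path t) x₀ u).det) *
        ‖normalPart (B.path t) ((chartAt (EuclideanSpace ℝ (Fin m)) x₀).symm u)
          (mfderiv 𝓘(ℝ, ℝ) (𝓡 n)
            (fun s => B.path s ((chartAt (EuclideanSpace ℝ (Fin m)) x₀).symm u)) t
              (1 : ℝ))‖ₑ ^ 2 ≤ β u) :
    horizontalSpeed B.path t ≤
      (∫⁻ u in chartAt (EuclideanSpace ℝ (Fin m)) x₀ '' K, β u) ^ (1 / 2 : ℝ) := by
  set φ := chartAt (EuclideanSpace ℝ (Fin m)) x₀ with hφ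
  refine ENNReal.rpow_le_rpow ?_ (by norm_num)
  have hzero : ∀ x ∉ K, mfderiv 𝓘(ℝ, ℝ) (𝓡 n) (fun s => B.path s x) t = 0 := by
    intro x hx
    have : (fun s => B.path s x) = fun _ => F x := by
      funext s
      change chartAdd y₀ F (fun x => (Real.smoothTransition s * h x) • e) x = F x
      refine chartAdd_of_eq_zero ?_
      simp [B.eq_zero x hx]
    rw [this]
    exact mfderiv_const
  have hzero' : ∀ x ∉ K, ‖normalPart (B.path t) x (mfderiv 𝓘(ℝ, ℝ) (𝓡 n)
      (fun s => B.path s x) t (1 : ℝ))‖ₑ ^ 2 = 0 := by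
    intro x hx
    rw [hzero x hx]
    have : normalPart (B.path t) x ((0 : ℝ →L[ℝ] TangentSpace (𝓡 n) (B.path t x)) (1 : ℝ)) = 0 :=
      map_zero _
    refine (congrArg (fun v => ‖v‖ₑ ^ 2) this).trans ?_
    simp
  refine (lintegral_vol_le (B.path t) x₀ _
    fun x hx => hzero' x fun hxK => hx (B.subset_source hxK)).trans ?_
  have hmeas : MeasurableSet (φ '' K) := B.isCompact_image.measurableSet
  rw [← lintegral_indicator hmeas]
  refine (setLIntegral_mono' φ.open_target.measurableSet (g := (φ '' K).indicator β)
    fun u hu => ?_).trans (setLIntegral_le_lintegral _ _)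
  by_cases huK : u ∈ φ '' K
  · rw [Set.indicator_of_mem huK]
    exact hβ u huK
  · have hu' : φ.symm u ∉ K := fun h1 => huK ⟨_, h1, φ.right_inv hu⟩
    refine le_of_eq_of_le ?_ zero_le
    exact (congrArg _ (hzero' _ hu')).trans (mul_zero _)

variable (m) in
/-- The oscillating factor `(1 + ς cos (k u_i)) / 2`, read in the preferred chart at `x₀`. -/
noncomputable def oscillation (x₀ : M) (i : Fin m) (ς : ℝ) (k : ℕ) (x : M) : ℝ :=
  (1 + ς * Real.cos (k * chartAt (EuclideanSpace ℝ (Fin m)) x₀ x i)) / 2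

omit [T2Space M] [IsManifold (𝓡 m) ∞ M] [MeasurableSpace M] [BorelSpace M] in
theorem oscillation_mem_Icc {i : Fin m} {ς : ℝ} (hς : |ς| ≤ 1) (k : ℕ) (x : M) :
    oscillation m x₀ i ς k x ∈ Set.Icc (0 : ℝ) 1 := by
  have h1 : |ς * Real.cos (k * chartAt (EuclideanSpace ℝ (Fin m)) x₀ x i)| ≤ 1 := by
    rw [abs_mul]
    exact mul_le_one₀ hς (abs_nonneg _) (Real.abs_cos_le_one _)
  have := abs_le.1 h1
  unfold oscillation
  constructor <;> linarith [this.1, this.2]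

omit [MeasurableSpace M] [BorelSpace M] [IsManifold (𝓡 n) ∞ N]
  [Bundle.RiemannianBundle (fun y : N => TangentSpace (𝓡 n) y)] in
theorem contMDiff_oscillation_mul (B : TransverseBump F x₀ y₀ e K W h) (i : Fin m) (ς : ℝ) (k : ℕ) :
    ContMDiff (𝓡 m) 𝓘(ℝ, ℝ) ∞ fun x => oscillation m x₀ i ς k x * h x := by
  intro x
  by_cases hx : x ∈ K
  · have hφ : ContMDiffAt (𝓡 m) (𝓡 m) ∞ (chartAt (EuclideanSpace ℝ (Fin m)) x₀) x :=
      contMDiffAt_of_mem_maximalAtlas (IsManifold.chart_mem_maximalAtlas x₀) (B.subset_source hx)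
    have hg : ContMDiff (𝓡 m) 𝓘(ℝ, ℝ) ∞ fun u : EuclideanSpace ℝ (Fin m) =>
        (1 + ς * Real.cos (k * u i)) / 2 := by
      rw [contMDiff_iff_contDiff]
      fun_prop
    exact (hg.contMDiffAt.comp x hφ).mul B.smooth.contMDiffAt
  · refine (contMDiffAt_const (c := (0 : ℝ))).congr_of_eventuallyEq ?_
    filter_upwards [B.isCompact.isClosed.isOpen_compl.mem_nhds hx] with x' hx'
    rw [B.eq_zero x' hx', mul_zero]

omit [MeasurableSpace M] [BorelSpace M] [IsManifold (𝓡 n) ∞ N]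
  [Bundle.RiemannianBundle (fun y : N => TangentSpace (𝓡 n) y)] in
/-- The bump `h`, multiplied with an oscillating factor. -/
theorem oscillate (B : TransverseBump F x₀ y₀ e K W h) (i : Fin m) {ς : ℝ} (hς : |ς| ≤ 1) (k : ℕ) :
    TransverseBump F x₀ y₀ e K W fun x => oscillation m x₀ i ς k x * h x :=
  B.mul (B.contMDiff_oscillation_mul i ς k) fun x => ⟨_, oscillation_mem_Icc hς k x, rfl⟩

omit [T2Space M] [MeasurableSpace M] [BorelSpace M] [IsManifold (𝓡 n) ∞ N]
  [Bundle.RiemannianBundle (fun y : N => TangentSpace (𝓡 n) y)] in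
/-- Lower bound for the derivative of an oscillating bump. -/
theorem le_abs_fderiv_oscillation_mul (B : TransverseBump F x₀ y₀ e K W h) (i : Fin m) {ς : ℝ}
    (hς : |ς| = 1) (k : ℕ) {u : EuclideanSpace ℝ (Fin m)}
    (hu : u ∈ (chartAt (EuclideanSpace ℝ (Fin m)) x₀).target) {H : ℝ}
    (hH : |fderiv ℝ (h ∘ (chartAt (EuclideanSpace ℝ (Fin m)) x₀).symm) u
      (EuclideanSpace.single i (1 : ℝ))| ≤ H) :
    k * (|h ((chartAt (EuclideanSpace ℝ (Fin m)) x₀).symm u)| * |Real.sin (k * u i)|) / 2 - H ≤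
      |fderiv ℝ ((fun x => oscillation m x₀ i ς k x * h x) ∘
        (chartAt (EuclideanSpace ℝ (Fin m)) x₀).symm) u (EuclideanSpace.single i (1 : ℝ))| := by
  set φ := chartAt (EuclideanSpace ℝ (Fin m)) x₀ with hφ
  have hhd : DifferentiableAt ℝ (h ∘ φ.symm) u := by
    rw [← mdifferentiableAt_iff_differentiableAt]
    exact (B.smooth.mdifferentiable (by simp) _).comp u
      ((mdifferentiable_chart x₀).mdifferentiableAt_symm hu)
  have heq : (fun x => oscillation m x₀ i ς k x * h x) ∘ φ.symm =ᶠ[nhds u]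
      fun u => (1 + ς * Real.cos (k * u i)) / 2 * (h ∘ φ.symm) u := by
    filter_upwards [φ.open_target.mem_nhds hu] with u' hu'
    simp only [oscillation, Function.comp, ← hφ, φ.right_inv hu']
  have hproj : HasFDerivAt (fun u : EuclideanSpace ℝ (Fin m) => u i)
      (EuclideanSpace.proj i : EuclideanSpace ℝ (Fin m) →L[ℝ] ℝ) u :=
    (EuclideanSpace.proj i : EuclideanSpace ℝ (Fin m) →L[ℝ] ℝ).hasFDerivAt
  have hosc : HasFDerivAt (fun u : EuclideanSpace ℝ (Fin m) => (1 + ς * Real.cos (k * u i)) / 2)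
      ((-(ς * k * Real.sin (k * u i)) / 2) •
        (EuclideanSpace.proj i : EuclideanSpace ℝ (Fin m) →L[ℝ] ℝ)) u := by
    have h1 : HasDerivAt (fun r : ℝ => (1 + ς * Real.cos (k * r)) / 2)
        (-(ς * k * Real.sin (k * u i)) / 2) (u i) := by
      have h2 := ((((hasDerivAt_id (u i)).const_mul (k : ℝ)).cos.const_mul ς).const_add 1).div_const
        2
      simp only [id, mul_one] at h2
      exact h2.congr_deriv (by ring)
    exact h1.comp_hasFDerivAt u hproj
  have hder := (hosc.mul hhd.hasFDerivAt).congr_of_eventuallyEq heq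
  rw [hder.fderiv]
  set D := fderiv ℝ (h ∘ φ.symm) u (EuclideanSpace.single i (1 : ℝ)) with hD
  set o := (1 + ς * Real.cos (k * u i)) / 2 with ho
  have hval : ((o • fderiv ℝ (h ∘ φ.symm) u + (h ∘ φ.symm) u •
      (-(ς * k * Real.sin (k * u i)) / 2) • (EuclideanSpace.proj i :
        EuclideanSpace ℝ (Fin m) →L[ℝ] ℝ)) (EuclideanSpace.single i (1 : ℝ))) =
      o * D + h (φ.symm u) * (-(ς * k * Real.sin (k * u i)) / 2) := by
    simp [hD]
  rw [hval]
  have ho1 : |o| ≤ 1 := by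
    have h1 : |ς * Real.cos (k * u i)| ≤ 1 := by
      rw [abs_mul, hς, one_mul]
      exact Real.abs_cos_le_one _
    have := abs_le.1 h1
    rw [ho, abs_le]
    constructor <;> linarith [this.1, this.2]
  have h3 : |o * D| ≤ H := by
    rw [abs_mul]
    exact (mul_le_of_le_one_left (abs_nonneg _) ho1).trans hH
  have h4 : |h (φ.symm u) * (-(ς * k * Real.sin (k * u i)) / 2)| =
      k * (|h (φ.symm u)| * |Real.sin (k * u i)|) / 2 := by
    rw [abs_mul, abs_div, abs_neg, abs_mul, abs_mul, hς, Nat.abs_cast, abs_two]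
    ring
  rw [← h4]
  have h5 := abs_sub_abs_le_abs_sub (h (φ.symm u) * (-(ς * k * Real.sin (k * u i)) / 2)) (-(o * D))
  rw [abs_neg, sub_neg_eq_add, add_comm (h (φ.symm u) * _)] at h5
  linarith

omit [T2Space M] [MeasurableSpace M] [BorelSpace M]
  [Bundle.RiemannianBundle (fun y : N => TangentSpace (𝓡 n) y)] in
theorem exists_norm_fderiv_le (B : TransverseBump F x₀ y₀ e K W h) :
    ∃ R, ∀ u ∈ chartAt (EuclideanSpace ℝ (Fin m)) x₀ '' K,
      ‖fderiv ℝ (chartAt (EuclideanSpace ℝ (Fin n)) y₀ ∘ F ∘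
        (chartAt (EuclideanSpace ℝ (Fin m)) x₀).symm) u‖ ≤ R := by
  refine B.isCompact_image.exists_bound_of_continuousOn ?_
  rintro _ ⟨x, hx, rfl⟩
  set φ := chartAt (EuclideanSpace ℝ (Fin m)) x₀ with hφ
  have hxs := B.subset_source hx
  have h1 : ContMDiffAt (𝓡 m) (𝓡 m) ∞ φ.symm (φ x) :=
    contMDiffAt_symm_of_mem_maximalAtlas (IsManifold.chart_mem_maximalAtlas x₀) (φ.map_source hxs)
  have hx' : φ.symm (φ x) = x := φ.left_inv hxs
  have h2 : ContMDiffAt (𝓡 n) (𝓡 n) ∞ (chartAt (EuclideanSpace ℝ (Fin n)) y₀)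
      (F (φ.symm (φ x))) :=
    contMDiffAt_of_mem_maximalAtlas (IsManifold.chart_mem_maximalAtlas y₀)
      (hx'.symm ▸ B.mem_source x hx)
  have h3 : ContDiffAt ℝ ∞ (chartAt (EuclideanSpace ℝ (Fin n)) y₀ ∘ F ∘ φ.symm) (φ x) :=
    contMDiffAt_iff_contDiffAt.1 (h2.comp (φ x) (F.smooth.contMDiffAt.comp (φ x) h1))
  exact (h3.fderiv_right (m := 0) (by simp)).continuousAt.continuousWithinAt

omit [T2Space M] [MeasurableSpace M] [BorelSpace M] [IsManifold (𝓡 n) ∞ N]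
  [Bundle.RiemannianBundle (fun y : N => TangentSpace (𝓡 n) y)] in
theorem exists_abs_le (B : TransverseBump F x₀ y₀ e K W h) (i : Fin m) :
    ∃ H, ∀ u ∈ chartAt (EuclideanSpace ℝ (Fin m)) x₀ '' K,
      |h ((chartAt (EuclideanSpace ℝ (Fin m)) x₀).symm u)| ≤ H ∧
      |fderiv ℝ (h ∘ (chartAt (EuclideanSpace ℝ (Fin m)) x₀).symm) u
        (EuclideanSpace.single i (1 : ℝ))| ≤ H := by
  set φ := chartAt (EuclideanSpace ℝ (Fin m)) x₀ with hφ
  have hsm : ∀ u ∈ φ '' K, ContDiffAt ℝ ∞ (h ∘ φ.symm) u := by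
    rintro _ ⟨x, hx, rfl⟩
    have h1 : ContMDiffAt (𝓡 m) (𝓡 m) ∞ φ.symm (φ x) :=
      contMDiffAt_symm_of_mem_maximalAtlas (IsManifold.chart_mem_maximalAtlas x₀)
        (φ.map_source (B.subset_source hx))
    exact contMDiffAt_iff_contDiffAt.1 (B.smooth.contMDiffAt.comp _ h1)
  obtain ⟨H₁, hH₁⟩ := B.isCompact_image.exists_bound_of_continuousOn (f := h ∘ φ.symm)
    fun u hu => (hsm u hu).continuousAt.continuousWithinAt
  obtain ⟨H₂, hH₂⟩ := B.isCompact_image.exists_bound_of_continuousOn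
    (f := fun u => fderiv ℝ (h ∘ φ.symm) u (EuclideanSpace.single i (1 : ℝ)))
    fun u hu => (((hsm u hu).fderiv_right (m := 0) (by simp)).continuousAt.clm_apply
      continuousAt_const).continuousWithinAt
  exact ⟨max H₁ H₂, fun u hu => ⟨(hH₁ u hu).trans (le_max_left _ _),
    (hH₂ u hu).trans (le_max_right _ _)⟩⟩

/-- The straight paths along sufficiently fast oscillating bumps are short. -/
theorem exists_horizontalLength_oscillate_lt (B : TransverseBump F x₀ y₀ e K W h) (i : Fin m)
    {C : ℝ} (hC : 0 ≤ C)
    (hCW : ∀ y ∈ (chartAt (EuclideanSpace ℝ (Fin n)) y₀).source,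
      chartAt (EuclideanSpace ℝ (Fin n)) y₀ y ∈ W →
        ∀ v, ‖chartSymmL (n := n) y₀ y v‖ ≤ C * ‖v‖)
    {ς : ℝ} (hς : |ς| = 1) {ε : ENNReal} (hε : 0 < ε) :
    ∃ k₀ : ℕ, ∀ k ≥ k₀, horizontalLength (B.oscillate i hς.le k).path < ε := by
  set φ := chartAt (EuclideanSpace ℝ (Fin m)) x₀ with hφ
  set L := φ '' K with hL
  obtain ⟨R₀, hR₀⟩ := B.exists_norm_fderiv_le
  obtain ⟨H₀, hH₀⟩ := B.exists_abs_le i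
  obtain ⟨S, hS⟩ := (isCompact_Icc (a := (0 : ℝ)) (b := 1)).exists_bound_of_continuousOn
    (f := deriv Real.smoothTransition)
    ((Real.smoothTransition.contDiff (n := 1)).continuous_deriv (by simp)).continuousOn
  set R := max R₀ ‖e‖ with hR
  set H := max H₀ 0 with hH
  have hH0 : 0 ≤ H := le_max_right _ _
  have hR0 : 0 ≤ R := (norm_nonneg e).trans (le_max_right _ _)
  set Q := C * R with hQ
  have hQ0 : 0 ≤ Q := mul_nonneg hC hR0
  set κ := √((m + 1).factorial * (Q ^ 2) ^ (m + 1)) with hκ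
  have hκ0 : 0 ≤ κ := Real.sqrt_nonneg _
  set D := κ * S ^ 2 * Q with hD
  have hD0 : 0 ≤ D := by positivity
  set a := ENNReal.ofReal (D * H ^ 2) with ha
  set V := volume L with hV
  have hVtop : V ≠ ⊤ := B.isCompact_image.measure_lt_top.ne
  have hLm : MeasurableSet L := B.isCompact_image.measurableSet
  have hε2 : 0 < ε / 2 := ENNReal.half_pos hε.ne'
  -- choice of the parameters
  obtain ⟨δ, hδ0, hδ1, hδ⟩ : ∃ δ : ℝ, 0 < δ ∧ δ < 1 ∧
      (a * V) ^ (1 / 2 : ℝ) * ENNReal.ofReal δ < ε / 2 := by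
    have h1 : Filter.Tendsto (fun δ : ℝ => (a * V) ^ (1 / 2 : ℝ) * ENNReal.ofReal δ) (nhds 0)
        (nhds ((a * V) ^ (1 / 2 : ℝ) * ENNReal.ofReal 0)) :=
      ENNReal.Tendsto.const_mul (ENNReal.continuous_ofReal.tendsto _) (Or.inr (by finiteness))
    rw [ENNReal.ofReal_zero, mul_zero] at h1
    obtain ⟨δ, ⟨h2, h3⟩, h4⟩ := (((h1.eventually_lt_const hε2).and
      (eventually_lt_nhds one_pos)).filter_mono nhdsWithin_le_nhds |>.and self_mem_nhdsWithin :
        ∀ᶠ δ in nhdsWithin (0 : ℝ) (Set.Ioi 0), _).exists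
    exact ⟨δ, h4, h3, h2⟩
  -- While `δ` makes the initial time interval negligible, `θ` bounds two things for later times:
  -- the energy over the good set, and the measure of the bad set where the density is only known to
  -- be at most `a`. This gives the total `θ + a * θ`.
  obtain ⟨θ, hθ0, hθ⟩ : ∃ θ : ENNReal, 0 < θ ∧ (θ + a * θ) ^ (1 / 2 : ℝ) < ε / 2 := by
    have h1 : Filter.Tendsto (fun r : ℝ => (ENNReal.ofReal r + a * ENNReal.ofReal r) ^ (1 / 2 : ℝ))
        (nhds 0) (nhds ((ENNReal.ofReal 0 + a * ENNReal.ofReal 0) ^ (1 / 2 : ℝ))) := by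
      refine (ENNReal.continuous_rpow_const.tendsto _).comp ?_
      exact (ENNReal.continuous_ofReal.tendsto _).add
        (ENNReal.Tendsto.const_mul (ENNReal.continuous_ofReal.tendsto _) (Or.inr (by finiteness)))
    rw [ENNReal.ofReal_zero, mul_zero, add_zero, ENNReal.zero_rpow_of_pos (by norm_num)] at h1
    obtain ⟨r, h2, h3⟩ := ((h1.eventually_lt_const hε2).filter_mono
      nhdsWithin_le_nhds |>.and self_mem_nhdsWithin :
        ∀ᶠ r in nhdsWithin (0 : ℝ) (Set.Ioi 0), _).exists
    exact ⟨ENNReal.ofReal r, ENNReal.ofReal_pos.2 h3, h2⟩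
  obtain ⟨η₀, hη₀, hbad⟩ := exists_volume_abs_sin_lt_le i B.isCompact_image.isBounded hθ0
  obtain ⟨η, hη0, hηη₀, hη⟩ : ∃ η : ℝ, 0 < η ∧ η ≤ η₀ ∧ ENNReal.ofReal (D * η ^ 2) * V ≤ θ := by
    have h1 : Filter.Tendsto (fun η : ℝ => ENNReal.ofReal (D * η ^ 2) * V) (nhds 0)
        (nhds (ENNReal.ofReal (D * 0 ^ 2) * V)) := by
      refine ENNReal.Tendsto.mul_const ?_ (Or.inr hVtop)
      exact (ENNReal.continuous_ofReal.tendsto _).comp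
        ((by fun_prop : Continuous fun η : ℝ => D * η ^ 2).tendsto 0)
    rw [zero_pow two_ne_zero, mul_zero, ENNReal.ofReal_zero, zero_mul] at h1
    obtain ⟨η, ⟨h2, h3⟩, h4⟩ := (((h1.eventually_lt_const hθ0).and
      (eventually_lt_nhds hη₀)).filter_mono nhdsWithin_le_nhds |>.and self_mem_nhdsWithin :
        ∀ᶠ η in nhdsWithin (0 : ℝ) (Set.Ioi 0), _).exists
    exact ⟨η, h4, h3.le, h2.le⟩
  set s₀ := Real.smoothTransition δ with hs₀
  have hs₀0 : 0 < s₀ := Real.smoothTransition.pos_of_pos hδ0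
  -- The frequency is chosen last, after `δ`, `θ` and `η`. The two thresholds are the hypotheses on
  -- `k` in `energy_density_le_of_oscillation`, and the measure estimate for the bad set needs `k ≥
  -- 1`.
  obtain ⟨k₁, hk₁⟩ := exists_nat_ge (4 * H / η ^ 2)
  obtain ⟨k₂, hk₂⟩ := exists_nat_ge (4 * H ^ 2 / (s₀ * η ^ 4))
  refine ⟨max (max k₁ k₂) 1, fun k hk => ?_⟩
  have hk1 : 1 ≤ k := (le_max_right _ _).trans hk
  have hkk₁ : 4 * H ≤ k * η ^ 2 := by
    rw [← div_le_iff₀ (by positivity)]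
    exact hk₁.trans (by exact_mod_cast ((le_max_left _ _).trans (le_max_left _ _)).trans hk)
  have hkk₂ : 4 * H ^ 2 ≤ k * (s₀ * η ^ 4) := by
    rw [← div_le_iff₀ (by positivity)]
    exact hk₂.trans (by exact_mod_cast ((le_max_right _ _).trans (le_max_left _ _)).trans hk)
  set B' := B.oscillate i hς.le k with hB'
  set bad : Set (EuclideanSpace ℝ (Fin m)) := {u | |Real.sin (k * u i)| < η} with hbad_def
  have hbadm : MeasurableSet bad := by
    have h1 : Continuous fun u : EuclideanSpace ℝ (Fin m) => |Real.sin (k * u i)| := by fun_prop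
    exact (isOpen_lt h1 continuous_const).measurableSet
  -- pointwise bounds of the energy density
  have hdens : ∀ t ∈ Set.Ioo (0 : ℝ) 1, ∀ u ∈ L, ∃ d : ℝ,
      ENNReal.ofReal (√(pullbackMatrix (m := m) (n := n) (B'.path t) x₀ u).det) *
        ‖normalPart (B'.path t) (φ.symm u) (mfderiv 𝓘(ℝ, ℝ) (𝓡 n)
            (fun s => B'.path s (φ.symm u)) t (1 : ℝ))‖ₑ ^ 2 ≤ ENNReal.ofReal d ∧
      d ≤ D * H ^ 2 ∧ (δ ≤ t → u ∉ bad → d ≤ D * η ^ 2) := by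
    intro t ht u hu
    have hut : u ∈ φ.target := by
      obtain ⟨x, hx, rfl⟩ := hu
      exact φ.map_source (B.subset_source hx)
    have huK : φ.symm u ∈ K := by
      obtain ⟨x, hx, rfl⟩ := hu
      rwa [φ.left_inv (B.subset_source hx)]
    obtain ⟨p, hp0, hpQ, hpd, hp⟩ := B'.density_le (R := R) hC hCW (le_max_right _ _) t hut huK
      fun j => ((ContinuousLinearMap.le_opNorm _ _).trans (by simpa using hR₀ u hu)).trans
        (le_max_left _ _)
    set w := oscillation m x₀ i ς k (φ.symm u) * h (φ.symm u) with hw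
    have hS' : |deriv Real.smoothTransition t| ≤ S := hS t ⟨ht.1.le, ht.2.le⟩
    have hhH : |h (φ.symm u)| ≤ H := (hH₀ u hu).1.trans (le_max_left _ _)
    have hosc := oscillation_mem_Icc (x₀ := x₀) (i := i) hς.le k (φ.symm u)
    have hwh : |w| ≤ |h (φ.symm u)| := by
      rw [hw, abs_mul, abs_of_nonneg hosc.1]
      exact mul_le_of_le_one_left (abs_nonneg _) hosc.2
    refine ⟨_, hp, ?_, fun htδ hub => ?_⟩
    · have h1 : deriv Real.smoothTransition t ^ 2 ≤ S ^ 2 :=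
        sq_le_sq' (by linarith [(abs_le.1 hS').1]) (abs_le.1 hS').2
      have h2 : w ^ 2 ≤ H ^ 2 := by
        rw [← sq_abs w]
        exact pow_le_pow_left₀ (abs_nonneg _) (hwh.trans hhH) 2
      calc κ * (deriv Real.smoothTransition t * w) ^ 2 * p
          = κ * (deriv Real.smoothTransition t ^ 2 * w ^ 2) * p := by ring
        _ ≤ κ * (S ^ 2 * H ^ 2) * Q := by gcongr
        _ = D * H ^ 2 := by rw [hD]; ring
    · exact energy_density_le_of_oscillation hκ0 hη0 hs₀0 hp0 hpQ hS'
        (Real.smoothTransition.monotone htδ) hhH hwh (hpd i) (not_lt.1 hub)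
        (B.le_abs_fderiv_oscillation_mul i hς k hut ((hH₀ u hu).2.trans (le_max_left _ _)))
        hkk₁ hkk₂ (Nat.cast_nonneg k)
  -- This crude bound, uniform in `k`, is used for `t < δ`, where `σ(t)` may be too small for the
  -- slopes to help.
  have hspeed₁ : ∀ t ∈ Set.Ioo (0 : ℝ) 1, horizontalSpeed B'.path t ≤ (a * V) ^ (1 / 2 : ℝ) := by
    intro t ht
    refine (B'.horizontalSpeed_path_le t (β := fun _ => a) fun u hu => ?_).trans_eq ?_
    · obtain ⟨d, hd, hd1, -⟩ := hdens t ht u hu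
      exact hd.trans (ENNReal.ofReal_le_ofReal hd1)
    · rw [setLIntegral_const]
  have hspeed₂ : ∀ t ∈ Set.Ioo (0 : ℝ) 1, δ ≤ t →
      horizontalSpeed B'.path t ≤ (θ + a * θ) ^ (1 / 2 : ℝ) := by
    intro t ht htδ
    refine (B'.horizontalSpeed_path_le t
      (β := fun u => ENNReal.ofReal (D * η ^ 2) + bad.indicator (fun _ => a) u)
      fun u hu => ?_).trans (ENNReal.rpow_le_rpow ?_ (by norm_num))
    · obtain ⟨d, hd, hd1, hd2⟩ := hdens t ht u hu
      by_cases hub : u ∈ bad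
      · rw [Set.indicator_of_mem hub]
        exact (hd.trans (ENNReal.ofReal_le_ofReal hd1)).trans le_add_self
      · exact (hd.trans (ENNReal.ofReal_le_ofReal (hd2 htδ hub))).trans le_self_add
    · rw [lintegral_add_left measurable_const, setLIntegral_const,
        lintegral_indicator_const hbadm, Measure.restrict_apply hbadm, Set.inter_comm]
      exact add_le_add hη (mul_le_mul_right (hbad η hηη₀ k hk1) a)
  calc horizontalLength B'.path
      = ∫⁻ t in Set.Ioo (0 : ℝ) 1, horizontalSpeed B'.path t := horizontalLength_eq_setLIntegral _
    _ ≤ ∫⁻ t in Set.Ioo (0 : ℝ) 1, ((Set.Iio δ).indicator (fun _ => (a * V) ^ (1 / 2 : ℝ)) t +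
          (θ + a * θ) ^ (1 / 2 : ℝ)) := by
        refine setLIntegral_mono' measurableSet_Ioo fun t ht => ?_
        by_cases htδ : t < δ
        · rw [Set.indicator_of_mem (show t ∈ Set.Iio δ from htδ)]
          exact (hspeed₁ t ht).trans le_self_add
        · exact (hspeed₂ t ht (not_lt.1 htδ)).trans le_add_self
    _ ≤ (a * V) ^ (1 / 2 : ℝ) * ENNReal.ofReal δ + (θ + a * θ) ^ (1 / 2 : ℝ) := by
        rw [lintegral_add_right _ measurable_const, setLIntegral_const,
          lintegral_indicator_const measurableSet_Iio, Measure.restrict_apply measurableSet_Iio,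
          Real.volume_Ioo]
        refine add_le_add (mul_le_mul_right ?_ _) (by simp)
        refine (measure_mono (t := Set.Ioo 0 δ) fun t ht => ⟨ht.2.1, ht.1⟩).trans ?_
        rw [Real.volume_Ioo, sub_zero]
    _ < ε / 2 + ε / 2 := ENNReal.add_lt_add hδ hθ
    _ = ε := ENNReal.add_halves ε

/-- The immersions `F` and `F + h • e` are joined by deformations of arbitrarily small horizontal
length. -/
theorem indistinguishable (B : TransverseBump F x₀ y₀ e K W h) (i : Fin m)
    {C : ℝ} (hC : 0 ≤ C)
    (hCW : ∀ y ∈ (chartAt (EuclideanSpace ℝ (Fin n)) y₀).source,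
      chartAt (EuclideanSpace ℝ (Fin n)) y₀ y ∈ W →
        ∀ v, ‖chartSymmL (n := n) y₀ y v‖ ≤ C * ‖v‖) :
    Indistinguishable F B.imm := by
  intro ε hε
  have hε2 : 0 < ε / 2 := ENNReal.half_pos hε.ne'
  have hp : |(1 : ℝ)| = 1 := abs_one
  have hm : |(-1 : ℝ)| = 1 := by simp
  have hB' : TransverseBump B.imm x₀ y₀ e K W fun x => -h x :=
    B.neg_mul B.smooth.neg fun x => ⟨1, by simp, by ring⟩
  obtain ⟨k₁, hk₁⟩ := B.exists_horizontalLength_oscillate_lt i hC hCW hp hε2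
  obtain ⟨k₂, hk₂⟩ := hB'.exists_horizontalLength_oscillate_lt i hC hCW hm hε2
  set k := max k₁ k₂ with hk
  -- The factors with signs `1` and `-1` add up to `1`, so `h - h (1 - cos)/2 = h (1 + cos)/2`. Both
  -- legs need the same frequency, hence the maximum `k`.
  have heq : (hB'.oscillate i hm.le k).imm = (B.oscillate i hp.le k).imm := by
    refine B.imm_neg_mul _ _ fun x => ?_
    unfold oscillation
    ring
  have h₁ := (B.oscillate i hp.le k).isDeformation_path
  have h₂ := (hB'.oscillate i hm.le k).isDeformation_path
  rw [heq] at h₂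
  refine ⟨_, h₁.concat h₂.reverse, (h₁.horizontalLength_concat_le h₂.reverse).trans_lt ?_⟩
  rw [h₂.horizontalLength_reverse, ← ENNReal.add_halves ε]
  exact ENNReal.add_lt_add (hk₁ k (le_max_left _ _)) (hk₂ k (le_max_right _ _))

end TransverseBump

end Oscillation

/-! ### Bases of transverse directions, and openness of transversality. -/

/-- A proper subspace of a vector space misses all vectors of a suitable basis. -/
theorem exists_basis_forall_notMem {V : Type*} [AddCommGroup V] [Module ℝ V] {S : Submodule ℝ V}
    (hS : S ≠ ⊤) : ∃ (s : Set V) (b : Module.Basis s ℝ V), ∀ i, b i ∉ S := by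
  obtain ⟨w, hw⟩ : ∃ w, w ∉ S := by
    by_contra! h
    exact hS (Submodule.eq_top_iff'.2 h)
  -- The complement of `S` spans: a vector `v` of `S` is `(v + w) - w`, and both terms lie outside
  -- `S`. A basis is then extracted from this spanning set.
  have hspan : ⊤ ≤ Submodule.span ℝ (Sᶜ : Set V) := by
    intro v _
    by_cases hv : v ∈ S
    · have h1 : v + w ∉ S := fun h => hw (by simpa using S.sub_mem h hv)
      have h2 := (Submodule.span ℝ (Sᶜ : Set V)).sub_mem (Submodule.subset_span h1)
        (Submodule.subset_span hw)
      simpa using h2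
    · exact Submodule.subset_span hv
  refine ⟨_, Module.Basis.ofSpan hspan, fun i => ?_⟩
  exact Module.Basis.ofSpan_subset hspan ⟨i, rfl⟩

section Families

variable {m n : ℕ} {M N : Type*}
  [TopologicalSpace M] [ChartedSpace (EuclideanSpace ℝ (Fin m)) M] [IsManifold (𝓡 m) ∞ M]
  [TopologicalSpace N] [ChartedSpace (EuclideanSpace ℝ (Fin n)) N] [IsManifold (𝓡 n) ∞ N]

omit [IsManifold (𝓡 m) ∞ M] [IsManifold (𝓡 n) ∞ N] in
theorem isTransverseAt_of_notMem_range {y₀ : N} {F : M → N} {e : EuclideanSpace ℝ (Fin n)} {x : M}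
    (hinj : Function.Injective (chartDeriv m (n := n) y₀ F x))
    (he : e ∉ LinearMap.range (chartDeriv m (n := n) y₀ F x).toLinearMap) :
    IsTransverseAt m y₀ F e x := by
  intro v c hvc
  have hc : c = 0 := by
    by_contra hc
    refine he ⟨-c⁻¹ • v, ?_⟩
    have h1 : chartDeriv m y₀ F x v = -(c • e) := eq_neg_of_add_eq_zero_left hvc
    have h2 : chartDeriv m y₀ F x (-c⁻¹ • v) = e := by
      rw [map_smul, h1, smul_neg, neg_smul, neg_neg, smul_smul, inv_mul_cancel₀ hc, one_smul]
    exact h2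
  subst hc
  rw [zero_smul, add_zero] at hvc
  exact ⟨(injective_iff_map_eq_zero _).1 hinj v hvc, rfl⟩

-- Positive codimension makes the image of the differential a proper subspace. A whole basis is
-- wanted so that any displacement is a sum of displacements in transverse directions.
omit [IsManifold (𝓡 m) ∞ M] in
theorem exists_basis_isTransverseAt (hmn : m < n) {y₀ : N} {F : M → N} {x : M}
    (hF : MDifferentiableAt (𝓡 m) (𝓡 n) F x)
    (h : F x ∈ (chartAt (EuclideanSpace ℝ (Fin n)) y₀).source)
    (hinj : Function.Injective (mfderiv (𝓡 m) (𝓡 n) F x)) :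
    ∃ (s : Set (EuclideanSpace ℝ (Fin n))) (b : Module.Basis s ℝ (EuclideanSpace ℝ (Fin n))),
      ∀ i, IsTransverseAt m y₀ F (b i) x := by
  have hcd : Function.Injective (chartDeriv m (n := n) y₀ F x) := by
    unfold chartDeriv
    rw [mfderiv_comp x ((mdifferentiable_chart y₀).mdifferentiableAt h) hF]
    exact ((mdifferentiable_chart y₀).mfderiv_injective h).comp hinj
  have hrange : LinearMap.range (chartDeriv m (n := n) y₀ F x).toLinearMap ≠ ⊤ := by
    intro htop
    have h1 := LinearMap.finrank_range_le (chartDeriv m (n := n) y₀ F x).toLinearMap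
    rw [htop, finrank_top, finrank_euclideanSpace_fin, finrank_euclideanSpace_fin] at h1
    omega
  obtain ⟨s, b, hb⟩ := exists_basis_forall_notMem hrange
  exact ⟨s, b, fun i => isTransverseAt_of_notMem_range hcd (hb i)⟩

/-- Transversality is an open condition. -/
theorem eventually_isTransverseAt {Φ : ℝ → M → N} {t₀ : ℝ} {x₁ : M} {y₀ : N}
    {e : EuclideanSpace ℝ (Fin n)}
    (hΦ : ContMDiffAt (𝓘(ℝ, ℝ).prod (𝓡 m)) (𝓡 n) ∞ (fun p : ℝ × M => Φ p.1 p.2) (t₀, x₁))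
    (h : Φ t₀ x₁ ∈ (chartAt (EuclideanSpace ℝ (Fin n)) y₀).source)
    (ht : IsTransverseAt m y₀ (Φ t₀) e x₁) :
    ∀ᶠ p : ℝ × M in nhds (t₀, x₁), IsTransverseAt m y₀ (Φ p.1) e p.2 := by
  set φ := chartAt (EuclideanSpace ℝ (Fin m)) x₁ with hφ
  set ψ := chartAt (EuclideanSpace ℝ (Fin n)) y₀ with hψ
  have hx₁ : x₁ ∈ φ.source := mem_chart_source _ x₁
  set G : ℝ × EuclideanSpace ℝ (Fin m) → EuclideanSpace ℝ (Fin n) :=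
    fun q => ψ (Φ q.1 (φ.symm q.2)) with hG
  have hGsm : ContDiffAt ℝ ∞ G (t₀, φ x₁) := by
    have h1 : ContMDiffAt (𝓡 m) (𝓡 m) ∞ φ.symm (φ x₁) :=
      contMDiffAt_symm_of_mem_maximalAtlas (IsManifold.chart_mem_maximalAtlas x₁)
        (φ.map_source hx₁)
    have h2 : ContMDiffAt (𝓘(ℝ, ℝ).prod (𝓡 m)) (𝓘(ℝ, ℝ).prod (𝓡 m)) ∞
        (fun q : ℝ × EuclideanSpace ℝ (Fin m) => (q.1, φ.symm q.2)) (t₀, φ x₁) :=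
      contMDiffAt_fst.prodMk (h1.comp (t₀, φ x₁) contMDiffAt_snd)
    have h3 : ContMDiffAt (𝓡 n) (𝓡 n) ∞ ψ (Φ t₀ x₁) :=
      contMDiffAt_of_mem_maximalAtlas (IsManifold.chart_mem_maximalAtlas y₀) h
    have hx₁' : φ.symm (φ x₁) = x₁ := φ.left_inv hx₁
    have h4 : ContMDiffAt (𝓘(ℝ, ℝ).prod (𝓡 m)) (𝓡 n) ∞ (fun p : ℝ × M => ψ (Φ p.1 p.2))
        (t₀, φ.symm (φ x₁)) := by
      rw [hx₁']
      exact h3.comp (t₀, x₁) hΦ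
    have h5 : ContMDiffAt (𝓘(ℝ, ℝ).prod (𝓡 m)) (𝓡 n) ∞ G (t₀, φ x₁) :=
      ContMDiffAt.comp (t₀, φ x₁) (g := fun p : ℝ × M => ψ (Φ p.1 p.2))
        (f := fun q => (q.1, φ.symm q.2)) h4 h2
    rw [← modelWithCornersSelf_prod, chartedSpaceSelf_prod] at h5
    exact contMDiffAt_iff_contDiffAt.1 h5
  set D : ℝ × EuclideanSpace ℝ (Fin m) →
      (EuclideanSpace ℝ (Fin m) →L[ℝ] EuclideanSpace ℝ (Fin n)) :=
    fun q => fderiv ℝ (fun u => G (q.1, u)) q.2 with hD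
  have hDcont : ContinuousAt D (t₀, φ x₁) := by
    have h1 : ContDiffAt ℝ 0 D (t₀, φ x₁) := by
      refine ContDiffAt.fderiv (n := 1) (f := fun (q : ℝ × EuclideanSpace ℝ (Fin m)) u =>
        G (q.1, u)) (g := fun q => q.2) ?_ contDiffAt_snd (by simp)
      have h2 : ContDiffAt ℝ 1 G (t₀, φ x₁) := hGsm.of_le (by norm_cast)
      refine ContDiffAt.comp ((t₀, φ x₁), φ x₁) (g := G) h2 (f := fun q :
        (ℝ × EuclideanSpace ℝ (Fin m)) × EuclideanSpace ℝ (Fin m) => (q.1.1, q.2)) ?_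
      fun_prop
    exact h1.continuousAt
  have hchain : ∀ᶠ p : ℝ × M in nhds (t₀, x₁), p.2 ∈ φ.source ∧
      chartDeriv m y₀ (Φ p.1) p.2 = (D (p.1, φ p.2)).comp (mfderiv (𝓡 m) (𝓡 m) φ p.2 :
        EuclideanSpace ℝ (Fin m) →L[ℝ] EuclideanSpace ℝ (Fin m)) := by
    have h1 : ∀ᶠ q in nhds (t₀, φ x₁), ContDiffAt ℝ 1 G q :=
      (hGsm.of_le (by norm_cast)).eventually (by simp)
    have h2 : ContinuousAt (fun p : ℝ × M => (p.1, φ p.2)) (t₀, x₁) :=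
      continuousAt_fst.prodMk ((φ.continuousAt hx₁).comp continuousAt_snd)
    filter_upwards [h2.eventually h1,
      continuousAt_snd.eventually_mem (φ.open_source.mem_nhds hx₁)] with p hp1 hp2
    refine ⟨hp2, ?_⟩
    have h3 : DifferentiableAt ℝ (fun u => G (p.1, u)) (φ p.2) :=
      (hp1.differentiableAt (by simp)).comp (φ p.2)
        (by fun_prop : DifferentiableAt ℝ (fun u : EuclideanSpace ℝ (Fin m) => (p.1, u)) (φ p.2))
    have h4 : ψ ∘ Φ p.1 =ᶠ[nhds p.2] (fun u => G (p.1, u)) ∘ φ := by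
      filter_upwards [φ.open_source.mem_nhds hp2] with x hx
      simp only [Function.comp, hG, φ.left_inv hx]
    have h5 : HasMFDerivAt (𝓡 m) (𝓡 n) (fun u => G (p.1, u)) (φ p.2) (D (p.1, φ p.2)) :=
      h3.hasFDerivAt.hasMFDerivAt
    have h6 := (h5.comp p.2
      ((mdifferentiable_chart x₁).mdifferentiableAt hp2).hasMFDerivAt).congr_of_eventuallyEq h4
    exact h6.mfderiv
  -- Transversality of `A` to `e` is injectivity of `(v, c) ↦ A v + c • e`, and injective operators
  -- form an open set in this finite-dimensional setting.
  set T : (EuclideanSpace ℝ (Fin m) →L[ℝ] EuclideanSpace ℝ (Fin n)) →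
      (EuclideanSpace ℝ (Fin m) × ℝ →L[ℝ] EuclideanSpace ℝ (Fin n)) :=
    fun A => A.comp (ContinuousLinearMap.fst ℝ _ _) +
      (ContinuousLinearMap.toSpanSingleton ℝ e).comp (ContinuousLinearMap.snd ℝ _ _) with hT
  have hTcont : Continuous T :=
    (continuous_id.clm_comp continuous_const).add continuous_const
  have hTinj : Function.Injective (T (D (t₀, φ x₁))) := by
    rw [injective_iff_map_eq_zero]
    rintro ⟨v, c⟩ hvc
    obtain ⟨v', hv'⟩ := (mdifferentiable_chart (I := 𝓡 m) x₁).mfderiv_surjective hx₁ v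
    have h0 : D (t₀, φ x₁) v + c • e = 0 := by simpa [hT] using hvc
    have h1 := ht v' c (by
      rw [hchain.self_of_nhds.2]
      rw [← hv'] at h0
      exact h0)
    refine Prod.ext ?_ h1.2
    change v = 0
    rw [← hv', h1.1]
    exact map_zero _
  have hev : ∀ᶠ p : ℝ × M in nhds (t₀, x₁), Function.Injective (T (D (p.1, φ p.2))) := by
    have h2 : ContinuousAt (fun p : ℝ × M => (p.1, φ p.2)) (t₀, x₁) :=
      continuousAt_fst.prodMk ((φ.continuousAt hx₁).comp continuousAt_snd)
    have h3 : ContinuousAt (fun p : ℝ × M => T (D (p.1, φ p.2))) (t₀, x₁) :=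
      ContinuousAt.comp (g := T) (f := fun p : ℝ × M => D (p.1, φ p.2)) hTcont.continuousAt
        (ContinuousAt.comp (g := D) (f := fun p : ℝ × M => (p.1, φ p.2)) hDcont h2)
    exact h3.eventually_mem (ContinuousLinearMap.isOpen_injective.mem_nhds hTinj)
  filter_upwards [hev, hchain] with p hp1 hp2 v c hvc
  rw [hp2.2] at hvc
  have h1 : T (D (p.1, φ p.2)) ((mfderiv (𝓡 m) (𝓡 m) φ p.2 :
      EuclideanSpace ℝ (Fin m) →L[ℝ] EuclideanSpace ℝ (Fin m)) v, c) = 0 := by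
    have h0 : D (p.1, φ p.2) ((mfderiv (𝓡 m) (𝓡 m) φ p.2 :
      EuclideanSpace ℝ (Fin m) →L[ℝ] EuclideanSpace ℝ (Fin m)) v) + c • e = 0 := hvc
    simpa [hT] using h0
  have h2 := (injective_iff_map_eq_zero _).1 hp1 _ h1
  exact ⟨(injective_iff_map_eq_zero _).1
    ((mdifferentiable_chart x₁).mfderiv_injective hp2.1) v (congrArg Prod.fst h2), congrArg Prod.snd h2⟩

end Families

/-! ### Smooth families of maps and stability of immersions. -/

section SmoothFamilies

variable {m n : ℕ} {M N : Type*}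
  [TopologicalSpace M] [ChartedSpace (EuclideanSpace ℝ (Fin m)) M]
  [TopologicalSpace N] [ChartedSpace (EuclideanSpace ℝ (Fin n)) N]

variable (m n) in
/-- The family of maps `Φ` is smooth at all times near `t₀`. -/
def SmoothNear (Φ : ℝ → M → N) (t₀ : ℝ) : Prop :=
  ∀ᶠ s in nhds t₀, ∀ x, ContMDiffAt (𝓘(ℝ, ℝ).prod (𝓡 m)) (𝓡 n) ∞
    (fun p : ℝ × M => Φ p.1 p.2) (s, x)

variable {Φ : ℝ → M → N} {t₀ : ℝ}

theorem SmoothNear.eventually_contMDiff (h : SmoothNear m n Φ t₀) :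
    ∀ᶠ s in nhds t₀, ContMDiff (𝓡 m) (𝓡 n) ∞ (Φ s) := by
  filter_upwards [h] with s hs x
  exact ContMDiffAt.comp x (g := fun p : ℝ × M => Φ p.1 p.2) (f := fun x => (s, x)) (hs x)
    (contMDiffAt_const.prodMk contMDiffAt_id)

variable [IsManifold (𝓡 m) ∞ M] [IsManifold (𝓡 n) ∞ N]

/-- On a compact manifold, being an immersion is an open condition. -/
theorem SmoothNear.eventually_injective_mfderiv [CompactSpace M] (hmn : m < n)
    (h : SmoothNear m n Φ t₀)
    (hinj : ∀ x, Function.Injective (mfderiv (𝓡 m) (𝓡 n) (Φ t₀) x)) :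
    ∀ᶠ s in nhds t₀, ∀ x, Function.Injective (mfderiv (𝓡 m) (𝓡 n) (Φ s) x) := by
  have key : ∀ᶠ s in nhds t₀, ∀ x ∈ (Set.univ : Set M), ContMDiff (𝓡 m) (𝓡 n) ∞ (Φ s) →
      Function.Injective (mfderiv (𝓡 m) (𝓡 n) (Φ s) x) := by
    refine isCompact_univ.eventually_forall_of_forall_eventually fun x _ => ?_
    have hsm := h.self_of_nhds x
    have hsrc : Φ t₀ x ∈ (chartAt (EuclideanSpace ℝ (Fin n)) (Φ t₀ x)).source :=
      mem_chart_source _ _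
    obtain ⟨s, b, hb⟩ := exists_basis_isTransverseAt hmn
      (h.eventually_contMDiff.self_of_nhds.mdifferentiable (by simp) x) hsrc (hinj x)
    have hne : Nonempty s := by
      rw [← not_isEmpty_iff]
      intro hs
      have h1 := Module.finrank_eq_nat_card_basis b
      rw [finrank_euclideanSpace_fin, Nat.card_of_isEmpty] at h1
      omega
    have hcont : ContinuousAt (fun p : ℝ × M => Φ p.1 p.2) (t₀, x) := hsm.continuousAt
    filter_upwards [eventually_isTransverseAt hsm hsrc (hb hne.some),
      hcont.eventually_mem ((chartAt _ (Φ t₀ x)).open_source.mem_nhds hsrc)] with p hp1 hp2 hp3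
    exact hp1.injective_mfderiv (hp3.mdifferentiable (by simp) p.2) hp2
  filter_upwards [key, h.eventually_contMDiff] with s hs1 hs2 x
  exact hs1 x trivial hs2

end SmoothFamilies

/-! ### From transverse bumps to arbitrary small deformations. -/

section Patches

variable {m n : ℕ} {M N : Type*}
  [TopologicalSpace M] [ChartedSpace (EuclideanSpace ℝ (Fin m)) M]
  [TopologicalSpace N] [ChartedSpace (EuclideanSpace ℝ (Fin n)) N] [IsManifold (𝓡 n) ∞ N]
  [Bundle.RiemannianBundle (fun y : N => TangentSpace (𝓡 n) y)]

/-- A compact subset `K` of a chart domain of `M` which `f` maps to a convex subset `W` of a chart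
of `N`, such that all vectors of the basis `b` are transverse to `f` on `K`. -/
structure TransversePatch {ι : Type*} (f : M → N) (x₀ : M) (y₀ : N)
    (b : Module.Basis ι ℝ (EuclideanSpace ℝ (Fin n))) (K : Set M)
    (W : Set (EuclideanSpace ℝ (Fin n))) (C : ℝ) : Prop where
  isCompact : IsCompact K
  subset_source : K ⊆ (chartAt (EuclideanSpace ℝ (Fin m)) x₀).source
  convex : Convex ℝ W
  isOpen : IsOpen W
  subset_target : W ⊆ (chartAt (EuclideanSpace ℝ (Fin n)) y₀).target
  nonneg : 0 ≤ C
  norm_le : ∀ y ∈ (chartAt (EuclideanSpace ℝ (Fin n)) y₀).source,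
    chartAt (EuclideanSpace ℝ (Fin n)) y₀ y ∈ W → ∀ v, ‖chartSymmL (n := n) y₀ y v‖ ≤ C * ‖v‖
  mem_source : ∀ x ∈ K, f x ∈ (chartAt (EuclideanSpace ℝ (Fin n)) y₀).source
  mem : ∀ x ∈ K, chartAt (EuclideanSpace ℝ (Fin n)) y₀ (f x) ∈ W
  transverse : ∀ i, ∀ x ∈ K, IsTransverseAt m y₀ f (b i) x

/-- All the conditions are open at `x₀`, and `W` is a ball around the image point in the chart. The
neighbourhood `U` serves every compact `K` inside it, because `K` will be the support of a partition
function chosen afterwards. -/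
theorem exists_transversePatch [IsManifold (𝓡 m) ∞ M]
    [IsContMDiffRiemannianBundle (𝓡 n) ∞ (EuclideanSpace ℝ (Fin n))
      (fun y : N => TangentSpace (𝓡 n) y)] (hmn : m < n) (f : Imm m n M N) (x₀ : M) :
    ∃ U : Set M, IsOpen U ∧ x₀ ∈ U ∧ ∃ (s : Set (EuclideanSpace ℝ (Fin n)))
      (b : Module.Basis s ℝ (EuclideanSpace ℝ (Fin n))) (y₀ : N)
      (W : Set (EuclideanSpace ℝ (Fin n))) (C : ℝ), ∀ K ⊆ U, IsCompact K →
        TransversePatch (m := m) f x₀ y₀ b K W C := by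
  set y₀ := f x₀ with hy₀
  set ψ := chartAt (EuclideanSpace ℝ (Fin n)) y₀ with hψ
  have hsrc : f x₀ ∈ ψ.source := mem_chart_source _ y₀
  obtain ⟨C, hC, hbound⟩ := eventually_norm_chartSymmL_le (n := n) y₀
  obtain ⟨s, b, hb⟩ := exists_basis_isTransverseAt hmn (f.smooth.mdifferentiable (by simp) x₀) hsrc
    (f.injective_mfderiv x₀)
  have : Finite s := Module.Finite.finite_basis b
  have hball : ∀ᶠ u in nhds (ψ y₀), u ∈ ψ.target ∧
      ∀ v, ‖chartSymmL (n := n) y₀ (ψ.symm u) v‖ ≤ C * ‖v‖ := by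
    have h1 := ψ.continuousAt_symm (ψ.map_source hsrc)
    rw [ContinuousAt, ψ.left_inv hsrc] at h1
    exact (ψ.open_target.eventually_mem (ψ.map_source hsrc)).and (h1.eventually hbound)
  obtain ⟨r, hr, hball⟩ := Metric.eventually_nhds_iff_ball.1 hball
  have htrans : ∀ᶠ x in nhds x₀, ∀ i, IsTransverseAt m y₀ f (b i) x := by
    rw [Filter.eventually_all]
    intro i
    have h1 : ContMDiffAt (𝓘(ℝ, ℝ).prod (𝓡 m)) (𝓡 n) ∞ (fun p : ℝ × M => f p.2) (0, x₀) :=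
      (f.smooth.comp contMDiff_snd).contMDiffAt
    have h2 := eventually_isTransverseAt (Φ := fun _ => f) h1 hsrc (hb i)
    exact (Continuous.prodMk_right (0 : ℝ)).continuousAt.eventually h2
  have hfc : ContinuousAt f x₀ := f.smooth.continuous.continuousAt
  have hψf : ContinuousAt (fun x => ψ (f x)) x₀ :=
    ContinuousAt.comp (g := ψ) (ψ.continuousAt hsrc) hfc
  have hU := (((chartAt (EuclideanSpace ℝ (Fin m)) x₀).open_source.eventually_mem
    (mem_chart_source _ x₀)).and (hfc.eventually_mem (ψ.open_source.mem_nhds hsrc))).and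
      ((hψf.eventually_mem (Metric.ball_mem_nhds _ hr)).and htrans)
  obtain ⟨U, hU, hUo, hUx⟩ := eventually_nhds_iff.1 hU
  refine ⟨U, hUo, hUx, s, b, y₀, Metric.ball (ψ y₀) r, C, fun K hK hKc => ?_⟩
  exact
    { isCompact := hKc
      subset_source := fun x hx => (hU x (hK hx)).1.1
      convex := convex_ball _ _
      isOpen := Metric.isOpen_ball
      subset_target := fun u hu => (hball u hu).1
      nonneg := hC.le
      norm_le := fun y hy hyW v => by
        have h1 := (hball _ hyW).2 v
        rwa [ψ.left_inv hy] at h1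
      mem_source := fun x hx => (hU x (hK hx)).1.2
      mem := fun x hx => (hU x (hK hx)).2.1
      transverse := fun i x hx => (hU x (hK hx)).2.2 i }

variable [MeasurableSpace M]

variable (m n) in
/-- The maps `f` and `g` are immersions joined by deformations of arbitrarily small horizontal
length. -/
def IndistinguishableMaps (f g : M → N) : Prop :=
  ∃ F G : Imm m n M N, F.toFun = f ∧ G.toFun = g ∧ Indistinguishable F G

omit [IsManifold (𝓡 n) ∞ N] in
omit [IsManifold (𝓡 n) ∞ N] in
theorem IndistinguishableMaps.trans {f g h : M → N} (h₁ : IndistinguishableMaps m n f g)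
    (h₂ : IndistinguishableMaps m n g h) : IndistinguishableMaps m n f h := by
  obtain ⟨F, G, rfl, rfl, hFG⟩ := h₁
  obtain ⟨G', H, hG', rfl, hGH⟩ := h₂
  obtain rfl : G' = G := Imm.ext fun x => congrFun hG' x
  exact ⟨F, H, rfl, rfl, hFG.trans hGH⟩

variable [CompactSpace M] [T2Space M] [BorelSpace M] [IsManifold (𝓡 m) ∞ M]
  {ι : Type*} {Φ Φ' : ℝ → M → N} {t₀ : ℝ} {x₀ : M} {y₀ : N}
  {b : Module.Basis ι ℝ (EuclideanSpace ℝ (Fin n))} {K : Set M}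
  {W : Set (EuclideanSpace ℝ (Fin n))} {C : ℝ}

namespace TransversePatch

omit [CompactSpace M] [MeasurableSpace M] [T2Space M] [BorelSpace M] [IsManifold (𝓡 m) ∞ M] in
theorem eventually_mem_source (P : TransversePatch (m := m) (Φ t₀) x₀ y₀ b K W C)
    (hΦ : SmoothNear m n Φ t₀) :
    ∀ᶠ s in nhds t₀, ∀ x ∈ K, Φ s x ∈ (chartAt (EuclideanSpace ℝ (Fin n)) y₀).source := by
  refine P.isCompact.eventually_forall_of_forall_eventually fun x hx => ?_
  have h1 : ContinuousAt (fun p : ℝ × M => Φ p.1 p.2) (t₀, x) := (hΦ.self_of_nhds x).continuousAt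
  exact h1.eventually_mem ((chartAt _ y₀).open_source.mem_nhds (P.mem_source x hx))

omit [CompactSpace M] [MeasurableSpace M] [T2Space M] [BorelSpace M] [IsManifold (𝓡 m) ∞ M] in
theorem eventually_add_mem (P : TransversePatch (m := m) (Φ t₀) x₀ y₀ b K W C)
    (hΦ : SmoothNear m n Φ t₀) {w : ℝ → M → EuclideanSpace ℝ (Fin n)}
    (hw : ∀ x ∈ K, ContinuousAt (fun p : ℝ × M => w p.1 p.2) (t₀, x))
    (hw₀ : ∀ x ∈ K, w t₀ x = 0) :
    ∀ᶠ s in nhds t₀, ∀ x ∈ K, chartAt (EuclideanSpace ℝ (Fin n)) y₀ (Φ s x) + w s x ∈ W := by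
  refine P.isCompact.eventually_forall_of_forall_eventually fun x hx => ?_
  have h1 : ContinuousAt (fun p : ℝ × M => Φ p.1 p.2) (t₀, x) := (hΦ.self_of_nhds x).continuousAt
  have h2 : ContinuousAt (fun p : ℝ × M => chartAt (EuclideanSpace ℝ (Fin n)) y₀ (Φ p.1 p.2))
      (t₀, x) :=
    ContinuousAt.comp (g := chartAt (EuclideanSpace ℝ (Fin n)) y₀)
      (f := fun p : ℝ × M => Φ p.1 p.2) ((chartAt _ y₀).continuousAt (P.mem_source x hx)) h1
  refine (h2.add (hw x hx)).eventually_mem (P.isOpen.mem_nhds ?_)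
  change chartAt (EuclideanSpace ℝ (Fin n)) y₀ (Φ t₀ x) + w t₀ x ∈ W
  rw [hw₀ x hx, add_zero]
  exact P.mem x hx

/-- A small deformation in one of the transverse directions of the patch. -/
theorem eventually_indistinguishableMaps_chartAdd_smul (hm : 1 ≤ m) (hmn : m < n)
    (P : TransversePatch (m := m) (Φ t₀) x₀ y₀ b K W C) (hΦ : SmoothNear m n Φ t₀)
    (hinj : ∀ x, Function.Injective (mfderiv (𝓡 m) (𝓡 n) (Φ t₀) x)) (i : ι) {h : ℝ → M → ℝ}
    (hsm : ∀ᶠ s in nhds t₀, ContMDiff (𝓡 m) 𝓘(ℝ, ℝ) ∞ (h s)) (hz : ∀ s, ∀ x ∉ K, h s x = 0)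
    (hadd : ∀ᶠ s in nhds t₀, ∀ x ∈ K,
      chartAt (EuclideanSpace ℝ (Fin n)) y₀ (Φ s x) + h s x • b i ∈ W) :
    ∀ᶠ s in nhds t₀,
      IndistinguishableMaps m n (Φ s) (chartAdd y₀ (Φ s) fun x => h s x • b i) := by
  have htr : ∀ᶠ s in nhds t₀, ∀ x ∈ K, IsTransverseAt m y₀ (Φ s) (b i) x :=
    P.isCompact.eventually_forall_of_forall_eventually fun x hx =>
      eventually_isTransverseAt (hΦ.self_of_nhds x) (P.mem_source x hx) (P.transverse i x hx)
  have hW := P.eventually_add_mem hΦ (w := fun _ _ => 0) (fun _ _ => continuousAt_const)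
    fun _ _ => rfl
  filter_upwards [hsm, hadd, htr, hW, P.eventually_mem_source hΦ, hΦ.eventually_contMDiff,
    hΦ.eventually_injective_mfderiv hmn hinj] with s h1 h2 h3 h4 h5 h6 h7
  let F : Imm m n M N := ⟨Φ s, h6, h7⟩
  have B : TransverseBump F x₀ y₀ (b i) K W (h s) :=
    { isCompact := P.isCompact
      subset_source := P.subset_source
      smooth := h1
      eq_zero := hz s
      convex := P.convex
      subset_target := P.subset_target
      mem_source := h5
      mem := fun x hx => by simpa using h4 x hx
      add_mem := h2
      transverse := h3 }
  exact ⟨F, B.imm, rfl, rfl, B.indistinguishable ⟨0, hm⟩ P.nonneg P.norm_le⟩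

/-- Small deformations which are constant outside a transverse patch. -/
theorem eventually_indistinguishableMaps [Finite ι] (hm : 1 ≤ m) (hmn : m < n)
    (P : TransversePatch (m := m) (Φ t₀) x₀ y₀ b K W C) (hΦ : SmoothNear m n Φ t₀)
    (hΦ' : SmoothNear m n Φ' t₀) (heq : Φ' t₀ = Φ t₀) (hoff : ∀ s, ∀ x ∉ K, Φ' s x = Φ s x)
    (hinj : ∀ x, Function.Injective (mfderiv (𝓡 m) (𝓡 n) (Φ t₀) x)) :
    ∀ᶠ s in nhds t₀, IndistinguishableMaps m n (Φ s) (Φ' s) := by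
  classical
  have := Fintype.ofFinite ι
  set ψ := chartAt (EuclideanSpace ℝ (Fin n)) y₀ with hψ
  -- The displacement in the chart. It vanishes off `K` whatever values the chart takes there, since
  -- `Φ'` and `Φ` agree at those points.
  set v : ℝ → M → EuclideanSpace ℝ (Fin n) := fun s x => ψ (Φ' s x) - ψ (Φ s x) with hv
  have hvoff : ∀ s, ∀ x ∉ K, v s x = 0 := fun s x hx => by
    simp only [hv, hoff s x hx, sub_self]
  have hv₀ : ∀ x, v t₀ x = 0 := fun x => by simp only [hv, heq, sub_self]
  have hP' : ∀ᶠ s in nhds t₀, ∀ x ∈ K, Φ' s x ∈ ψ.source :=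
    TransversePatch.eventually_mem_source (b := b) (heq ▸ P) hΦ'
  have hvsm : ∀ᶠ s in nhds t₀, ∀ x, ContMDiffAt (𝓘(ℝ, ℝ).prod (𝓡 m)) (𝓡 n) ∞
      (fun p : ℝ × M => v p.1 p.2) (s, x) := by
    have hψsm : ∀ y ∈ ψ.source, ContMDiffAt (𝓡 n) (𝓡 n) ∞ ψ y := fun y hy =>
      contMDiffAt_of_mem_maximalAtlas (IsManifold.chart_mem_maximalAtlas y₀) hy
    filter_upwards [P.eventually_mem_source hΦ, hP', hΦ, hΦ'] with s h1 h2 h3 h4 x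
    by_cases hx : x ∈ K
    · exact (ContMDiffAt.comp (s, x) (f := fun p : ℝ × M => Φ' p.1 p.2) (hψsm _ (h2 x hx))
        (h4 x)).sub (ContMDiffAt.comp (s, x) (f := fun p : ℝ × M => Φ p.1 p.2)
          (hψsm _ (h1 x hx)) (h3 x))
    · refine (contMDiffAt_const (c := (0 : EuclideanSpace ℝ (Fin n)))).congr_of_eventuallyEq ?_
      filter_upwards [continuousAt_snd.eventually_mem
        (P.isCompact.isClosed.isOpen_compl.mem_nhds hx)] with p hp
      exact hvoff p.1 p.2 hp
  -- `A T` keeps the components along the basis vectors in `T`, so that the displacement can be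
  -- performed one transverse direction at a time.
  let A : Finset ι → EuclideanSpace ℝ (Fin n) →L[ℝ] EuclideanSpace ℝ (Fin n) := fun T =>
    ∑ k ∈ T, (LinearMap.toContinuousLinearMap (b.coord k)).smulRight (b k)
  have hA : ∀ T u, A T u = ∑ k ∈ T, b.repr u k • b k := fun T u => by
    simp [A]
  have hAsm : ∀ᶠ s in nhds t₀, ∀ T x, ContMDiffAt (𝓘(ℝ, ℝ).prod (𝓡 m)) (𝓡 n) ∞
      (fun p : ℝ × M => A T (v p.1 p.2)) (s, x) := by
    filter_upwards [hvsm] with s hs T x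
    exact ContMDiffAt.comp (s, x) (f := fun p : ℝ × M => v p.1 p.2)
      (A T).contMDiff.contMDiffAt (hs x)
  have hAW : ∀ T, ∀ᶠ s in nhds t₀, ∀ x ∈ K, ψ (Φ s x) + A T (v s x) ∈ W := fun T =>
    P.eventually_add_mem hΦ (w := fun s x => A T (v s x))
      (fun x _ => (hAsm.self_of_nhds T x).continuousAt) fun x _ => by simp only [hv₀, map_zero]
  have hadd : ∀ T, ∀ᶠ s in nhds t₀, ∀ x ∈ K,
      ChartAddable y₀ (Φ s) (fun x => A T (v s x)) x := fun T => by
    filter_upwards [P.eventually_mem_source hΦ, hAW T] with s h1 h2 x hx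
    exact ⟨h1 x hx, P.subset_target (h2 x hx)⟩
  let Ψ : Finset ι → ℝ → M → N := fun T s => chartAdd y₀ (Φ s) fun x => A T (v s x)
  have hΨ₀ : ∀ T, Ψ T t₀ = Φ t₀ := fun T => by
    funext x
    exact chartAdd_of_eq_zero (by rw [hv₀, map_zero])
  have hΨsm : ∀ T, SmoothNear m n (Ψ T) t₀ := fun T => by
    filter_upwards [hadd T, hΦ, hAsm] with s h1 h2 h3 x
    by_cases hx : x ∈ K
    · exact ChartAddable.contMDiffAt (F := fun p : ℝ × M => Φ p.1 p.2)
        (v := fun p : ℝ × M => A T (v p.1 p.2)) (h2 x) (h3 T x) (h1 x hx)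
    · refine (h2 x).congr_of_eventuallyEq ?_
      filter_upwards [continuousAt_snd.eventually_mem
        (P.isCompact.isClosed.isOpen_compl.mem_nhds hx)] with p hp
      exact chartAdd_of_eq_zero (by rw [hvoff p.1 p.2 hp, map_zero])
  have hstep : ∀ T : Finset ι, ∀ᶠ s in nhds t₀, IndistinguishableMaps m n (Φ s) (Ψ T s) := by
    intro T
    induction T using Finset.induction_on with
    | empty =>
      filter_upwards [hΦ.eventually_contMDiff, hΦ.eventually_injective_mfderiv hmn hinj]
        with s h1 h2
      refine ⟨⟨Φ s, h1, h2⟩, ⟨Φ s, h1, h2⟩, rfl, ?_, Indistinguishable.refl _⟩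
      funext x
      exact (chartAdd_of_eq_zero (by simp [A])).symm
    | insert k T hk ih =>
      have hins : ∀ u, A T u + b.repr u k • b k = A (insert k T) u := fun u => by
        rw [hA, hA, Finset.sum_insert hk, add_comm]
      -- Every intermediate family `Ψ T` passes through `Φ t₀` at time `t₀`, so the same patch
      -- serves at each step of the induction.
      have h1 := TransversePatch.eventually_indistinguishableMaps_chartAdd_smul hm hmn
        (Φ := Ψ T) ((hΨ₀ T).symm ▸ P) (hΨsm T) ((hΨ₀ T).symm ▸ hinj) k
        (h := fun s x => b.repr (v s x) k) ?_ ?_ ?_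
      · filter_upwards [ih, h1, hadd T] with s h2 h3 h4
        refine h2.trans ?_
        convert h3 using 1
        funext x
        refine Eq.trans ?_ (chartAdd_chartAdd (F := Φ s) ?_).symm
        · simp only [hins]; rfl
        · by_cases hx : x ∈ K
          · exact Or.inl (h4 x hx)
          · exact Or.inr (by simp [hvoff s x hx])
      · filter_upwards [hvsm] with s hs x
        have h2 : ContMDiffAt (𝓡 m) (𝓡 n) ∞ (v s) x :=
          ContMDiffAt.comp x (g := fun p : ℝ × M => v p.1 p.2) (f := fun x => (s, x)) (hs x)
            (contMDiffAt_const.prodMk contMDiffAt_id)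
        exact ContMDiffAt.comp x
          (LinearMap.toContinuousLinearMap (b.coord k)).contMDiff.contMDiffAt h2
      · intro s x hx
        simp [hvoff s x hx]
      · filter_upwards [hAW (insert k T), hadd T] with s h2 h3 x hx
        have h4 := (h3 x hx).chart_chartAdd
        have h5 := h2 x hx
        rw [← hins, ← add_assoc, ← h4] at h5
        exact h5
  filter_upwards [hstep Finset.univ, hP', P.eventually_mem_source hΦ] with s h1 h2 h3
  convert h1 using 1
  funext x
  have hx' : A Finset.univ (v s x) = v s x := by rw [hA, b.sum_repr]
  by_cases hx : x ∈ K
  · refine Eq.trans ?_ (chartAdd_of_mem (h3 x hx)).symm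
    rw [hx']
    simp only [hv]
    rw [add_sub_cancel, ψ.left_inv (h2 x hx)]
  · rw [hoff s x hx]
    exact (chartAdd_of_eq_zero (by rw [hvoff s x hx, map_zero])).symm

end TransversePatch

/-- All members of a smooth family of immersions of a compact manifold which are close to a given
one are indistinguishable from it. -/
theorem eventually_indistinguishable [IsContMDiffRiemannianBundle (𝓡 n) ∞
    (EuclideanSpace ℝ (Fin n)) (fun y : N => TangentSpace (𝓡 n) y)] (hm : 1 ≤ m) (hmn : m < n)
    {Γ : ℝ → Imm m n M N}
    (hΓ : ContMDiff (𝓘(ℝ, ℝ).prod (𝓡 m)) (𝓡 n) ∞ (fun p : ℝ × M => Γ p.1 p.2)) (t₀ : ℝ) :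
    ∀ᶠ s in nhds t₀, Indistinguishable (Γ t₀) (Γ s) := by
  classical
  choose U hUo hUx s b y₀ W C hP using exists_transversePatch (m := m) (n := n) hmn (Γ t₀)
  obtain ⟨T, hT⟩ := CompactSpace.elim_nhds_subcover U fun x => (hUo x).mem_nhds (hUx x)
  obtain ⟨f, hf⟩ := SmoothPartitionOfUnity.exists_isSubordinate (𝓡 m) isClosed_univ
    (fun x : T => U x) (fun x => hUo x) (by
      intro x _
      have hx : x ∈ ⋃ x ∈ T, U x := by rw [hT]; trivial
      simpa using hx)
  -- The time at `x` is advanced only by the fraction of `s - t₀` given by the partition functions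
  -- in `S`. Inserting `i` changes the map only on the support of `f i`, and the full sum gives `Γ
  -- s`.
  let Ψ : Finset T → ℝ → M → N := fun S s x => Γ (t₀ + (s - t₀) * ∑ i ∈ S, f i x) x
  have hΨ₀ : ∀ S, Ψ S t₀ = Γ t₀ := fun S => by
    funext x
    simp only [Ψ, sub_self, zero_mul, add_zero]
  have hΨsm : ∀ S, SmoothNear m n (Ψ S) t₀ := fun S => by
    refine Filter.Eventually.of_forall fun s x => ?_
    have h1 : ContMDiff (𝓘(ℝ, ℝ).prod (𝓡 m)) 𝓘(ℝ, ℝ) ∞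
        (fun p : ℝ × M => ∑ i ∈ S, f i p.2) :=
      ContMDiff.sum fun i _ => (f i).contMDiff.comp contMDiff_snd
    have h2 : ContMDiff (𝓘(ℝ, ℝ).prod (𝓡 m)) 𝓘(ℝ, ℝ) ∞
        (fun p : ℝ × M => t₀ + (p.1 - t₀) * ∑ i ∈ S, f i p.2) :=
      contMDiff_const.add ((contMDiff_fst.sub contMDiff_const).mul h1)
    exact (hΓ.comp (h2.prodMk contMDiff_snd)) (s, x)
  have hstep : ∀ S, ∀ᶠ s in nhds t₀, IndistinguishableMaps m n (Γ t₀) (Ψ S s) := by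
    intro S
    induction S using Finset.induction_on with
    | empty =>
      refine Filter.Eventually.of_forall fun s => ⟨Γ t₀, Γ t₀, rfl, ?_, Indistinguishable.refl _⟩
      funext x
      simp [Ψ]
    | insert i S hi ih =>
      have hfin : Finite (s i) := Module.Finite.finite_basis (b i)
      have hPi := hP i (tsupport (f i)) (hf i) (isClosed_tsupport _).isCompact
      have h1 := TransversePatch.eventually_indistinguishableMaps hm hmn (Φ := Ψ S)
        (Φ' := Ψ (insert i S)) (by rw [hΨ₀]; exact hPi) (hΨsm S) (hΨsm _)
        (by rw [hΨ₀, hΨ₀]) (fun s x hx => by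
          simp only [Ψ]
          rw [Finset.sum_insert hi, image_eq_zero_of_notMem_tsupport hx, zero_add])
        (by rw [hΨ₀]; exact (Γ t₀).injective_mfderiv)
      filter_upwards [ih, h1] with s h2 h3 using h2.trans h3
  filter_upwards [hstep Finset.univ] with s hs
  obtain ⟨F, G, hF, hG, hFG⟩ := hs
  obtain rfl : F = Γ t₀ := Imm.ext fun x => congrFun hF x
  obtain rfl : G = Γ s := Imm.ext fun x => by
    rw [hG]
    have h1 : ∑ i, f i x = 1 := by
      rw [← finsum_eq_sum_of_fintype]; exact f.sum_eq_one trivial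
    simp only [Ψ, h1, mul_one, add_sub_cancel]
  exact hFG

/-- The ends of a smooth path of immersions of a compact manifold are indistinguishable. -/
theorem IsSmoothPath.indistinguishable [IsContMDiffRiemannianBundle (𝓡 n) ∞
    (EuclideanSpace ℝ (Fin n)) (fun y : N => TangentSpace (𝓡 n) y)] (hm : 1 ≤ m) (hmn : m < n)
    {γ : ℝ → Imm m n M N} (hγ : IsSmoothPath γ) : Indistinguishable (γ 0) (γ 1) := by
  -- The reparametrization extends the path smoothly to all times, using only its values on `[0,
  -- 1]`.
  set Γ : ℝ → Imm m n M N := fun s => γ (Real.smoothTransition s) with hΓdef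
  have hΓ : ContMDiff (𝓘(ℝ, ℝ).prod (𝓡 m)) (𝓡 n) ∞ (fun p : ℝ × M => Γ p.1 p.2) := by
    have h1 : ContMDiff 𝓘(ℝ, ℝ) 𝓘(ℝ, ℝ) ∞ Real.smoothTransition :=
      Real.smoothTransition.contDiff.contMDiff
    exact hγ.comp_contMDiff ((h1.comp contMDiff_fst).prodMk contMDiff_snd) fun p =>
      ⟨⟨Real.smoothTransition.nonneg _, Real.smoothTransition.le_one _⟩, trivial⟩
  -- The class of `Γ 0` and its complement are both open, by the local statement together with
  -- symmetry and transitivity; the line is connected.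
  have hclopen : IsClopen {s | Indistinguishable (Γ 0) (Γ s)} := by
    refine ⟨⟨isOpen_iff_mem_nhds.2 fun t ht => ?_⟩, isOpen_iff_mem_nhds.2 fun t ht => ?_⟩
    · filter_upwards [eventually_indistinguishable hm hmn hΓ t] with s hs hs'
      exact ht (hs'.trans hs.symm)
    · filter_upwards [eventually_indistinguishable hm hmn hΓ t] with s hs
      exact ht.trans hs
  have h1 : (1 : ℝ) ∈ {s | Indistinguishable (Γ 0) (Γ s)} := by
    rw [hclopen.eq_univ ⟨0, Indistinguishable.refl _⟩]
    trivial
  simpa [hΓdef, Real.smoothTransition.zero, Real.smoothTransition.one] using h1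

end Patches

end ShapeSpace

theorem theorem3p2 {m n : ℕ} (hm : 1 ≤ m) (hmn : m < n)
    {M : Type*} [TopologicalSpace M] [T2Space M] [CompactSpace M] [ConnectedSpace M]
    [ChartedSpace (EuclideanSpace ℝ (Fin m)) M] [IsManifold (𝓡 m) ∞ M]
    [MeasurableSpace M] [BorelSpace M]
    {N : Type*} [TopologicalSpace N] [T2Space N] [ConnectedSpace N]
    [ChartedSpace (EuclideanSpace ℝ (Fin n)) N] [IsManifold (𝓡 n) ∞ N]
    [Bundle.RiemannianBundle (fun y : N => TangentSpace (𝓡 n) y)]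
    [IsContMDiffRiemannianBundle (𝓡 n) ∞ (EuclideanSpace ℝ (Fin n))
      (fun y : N => TangentSpace (𝓡 n) y)]
    (f₀ f₁ : ShapeSpace.Imm m n M N)
    (hjoin : ∃ γ : ℝ → ShapeSpace.Imm m n M N, ShapeSpace.IsSmoothPath γ ∧ γ 0 = f₀ ∧
      ShapeSpace.proj (γ 1) = ShapeSpace.proj f₁) :
    (∀ ε : ENNReal, 0 < ε → ∃ γ : ℝ → ShapeSpace.Imm m n M N, ShapeSpace.IsSmoothPath γ ∧
      γ 0 = f₀ ∧ ShapeSpace.proj (γ 1) = ShapeSpace.proj f₁ ∧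
      ShapeSpace.horizontalLength γ < ε) ∧
    ShapeSpace.geodesicDist (ShapeSpace.proj f₀) (ShapeSpace.proj f₁) = 0 := by
  obtain ⟨γ, hγ, h0, h1⟩ := hjoin
  have key : ∀ ε : ENNReal, 0 < ε → ∃ γ : ℝ → ShapeSpace.Imm m n M N, ShapeSpace.IsSmoothPath γ ∧
      γ 0 = f₀ ∧ ShapeSpace.proj (γ 1) = ShapeSpace.proj f₁ ∧
      ShapeSpace.horizontalLength γ < ε := by
    intro ε hε
    obtain ⟨δ, hδ, hlt⟩ := hγ.indistinguishable hm hmn ε hε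
    exact ⟨δ, hδ.isSmoothPath, (hδ.eq_left 0 le_rfl).trans h0,
      by rw [hδ.eq_right 1 le_rfl, h1], hlt⟩
  refine ⟨key, nonpos_iff_eq_zero.1 (le_of_forall_pos_lt_add' fun ε hε => ?_)⟩
  obtain ⟨δ, hδ, hδ0, hδ1, hlt⟩ := key ε hε
  rw [zero_add]
  exact (iInf₂_le_of_le δ hδ (iInf₂_le_of_le (by rw [hδ0]) hδ1 le_rfl)).trans_lt hlt
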